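/- All topological groups are Hausdorff. For a metric space $(X,d)$, $\mathrm{Iso}(X,d)$ denotes the group of all bijective isometries of $X$ with the topology of pointwise convergence; isomorphisms of topological groups are group isomorphisms that are homeomorphisms. The weight $w(Y)$ of a topological space $Y$ is the least infinite cardinal $\kappa$ such that $Y$ has a base of at most $\kappa$ sets. A topological group $G$ is \emph{complete} (Raïkov-complete) if it is complete with respect to its upper uniformity, i.e. the coarsest uniformity finer than both the left and the right uniformity of $G$. For a topology $\tau$, $\tau_\delta$ denotes the topology whose base consists of all $\mathcal G_\delta$-sets with respect to $\tau$; if $(G,\tau)$ is a topological group, then so is $(G,\tau_\delta)$, and $(G,\tau)$ is called \emph{$\mathcal G_\delta$-complete} if the topological group $(G,\tau_\delta)$ is complete. **Theorem 1.4.** Let $G$ be a topological group. (A) The following conditions are equivalent: - (A1) there exists a metric space $(X,d)$ such that $G$ is isomorphic to $\mathrm{Iso}(X,d)$; - (A2) $G$ is $\mathcal G_\delta$-complete. Moreover, if $G$ is $\mathcal G_\delta$-complete, the space $X$ witnessing (A1) may be chosen so that $w(X)=w(G)$. (B) The following conditions are equivalent: - (B1) there exists a complete metric space $(X,d)$ such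 that $G$ is isomorphic to $\mathrm{Iso}(X,d)$; - (B2) $G$ is complete. Moreover, if $G$ is complete, the space $X$ witnessing (B1) may be chosen so that $w(X)=w(G)$. -/

import Mathlib

open Topology Cardinal

universe u v

/-- The isometry group of a metric space (all bijective isometries `X → X`, with composition)
carries the topology of pointwise convergence. -/
instance isometryGroupTopology (X : Type*) [PseudoMetricSpace X] : TopologicalSpace (X ≃ᵢ X) :=
  TopologicalSpace.induced (fun f : X ≃ᵢ X => (f : X → X)) Pi.topologicalSpace

/-- The topological weight, understood as an infinite cardinal: the least infinite cardinal `κ`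
such that the space has a base of at most `κ` sets. -/
noncomputable def topWeight (X : Type u) [TopologicalSpace X] : Cardinal.{u} :=
  max ℵ₀ (sInf {κ : Cardinal.{u} |
    ∃ B : Set (Set X), TopologicalSpace.IsTopologicalBasis B ∧ #B = κ})

/-- A topological group is Raïkov-complete (complete) if it is complete with respect to the upper
uniformity, the coarsest uniformity that is finer than both the left and the right uniformity
(in Mathlib's order on uniformities, finer means smaller, so this is the infimum). -/
def IsRaikovComplete (G : Type*) [Group G] [TopologicalSpace G] [IsTopologicalGroup G] : Prop :=
  @CompleteSpace G
    (IsTopologicalGroup.leftUniformSpace G ⊓ IsTopologicalGroup.rightUniformSpace G)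

/-- The topology `τ_δ` whose base consists of all `G_δ`-sets of the given topology. -/
@[reducible]
def gdeltaTopology (X : Type*) [TopologicalSpace X] : TopologicalSpace X :=
  TopologicalSpace.generateFrom {s : Set X | IsGδ s}

theorem isTopologicalBasis_gdelta (X : Type*) [TopologicalSpace X] :
    @TopologicalSpace.IsTopologicalBasis X (gdeltaTopology X) {s : Set X | IsGδ s} := by
  refine @TopologicalSpace.IsTopologicalBasis.mk X (gdeltaTopology X) _ ?_ ?_ rfl
  · intro s hs t ht x hx
    exact ⟨s ∩ t, IsGδ.inter hs ht, hx, subset_rfl⟩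
  · exact Set.eq_univ_of_forall fun x => ⟨Set.univ, IsGδ.univ, trivial⟩

theorem mem_nhds_gdelta {X : Type*} [TopologicalSpace X] {x : X} {s : Set X} :
    s ∈ @nhds X (gdeltaTopology X) x ↔ ∃ t, IsGδ t ∧ x ∈ t ∧ t ⊆ s :=
  @TopologicalSpace.IsTopologicalBasis.mem_nhds_iff X (gdeltaTopology X) x s _
    (isTopologicalBasis_gdelta X)

/-- If `(G, τ)` is a topological group, then so is `(G, τ_δ)`. -/
theorem isTopologicalGroup_gdelta (G : Type*) [Group G] [TopologicalSpace G]
    [IsTopologicalGroup G] : @IsTopologicalGroup G (gdeltaTopology G) _ := by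
  refine @IsTopologicalGroup.mk G (gdeltaTopology G) _
    (@ContinuousMul.mk G (gdeltaTopology G) _ ?_) (@ContinuousInv.mk G (gdeltaTopology G) _ ?_)
  · refine (@continuous_iff_continuousAt (G × G) G
      (@instTopologicalSpaceProd G G (gdeltaTopology G) (gdeltaTopology G))
      (gdeltaTopology G) _).2 ?_
    rintro ⟨a, b⟩ s hs
    obtain ⟨t, ht, hab, hts⟩ := mem_nhds_gdelta.1 hs
    obtain ⟨f, hfo, rfl⟩ := isGδ_iff_eq_iInter_nat.1 ht
    have key : ∀ n, ∃ U V : Set G, IsOpen U ∧ IsOpen V ∧ a ∈ U ∧ b ∈ V ∧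
        U ×ˢ V ⊆ (fun p : G × G => p.1 * p.2) ⁻¹' f n := fun n =>
      isOpen_prod_iff.1 ((hfo n).preimage continuous_mul) a b (Set.mem_iInter.1 hab n)
    choose U V hU hV haU hbV hUV using key
    rw [Filter.mem_map, @nhds_prod_eq G G (gdeltaTopology G) (gdeltaTopology G)]
    refine Filter.mem_prod_iff.2 ⟨⋂ n, U n, mem_nhds_gdelta.2
      ⟨_, IsGδ.iInter_of_isOpen hU, Set.mem_iInter.2 haU, subset_rfl⟩, ⋂ n, V n,
      mem_nhds_gdelta.2 ⟨_, IsGδ.iInter_of_isOpen hV, Set.mem_iInter.2 hbV, subset_rfl⟩, ?_⟩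
    rintro ⟨x, y⟩ ⟨hx, hy⟩
    exact hts (Set.mem_iInter.2 fun n =>
      hUV n ⟨Set.mem_iInter.1 hx n, Set.mem_iInter.1 hy n⟩)
  · refine (@continuous_iff_continuousAt G G (gdeltaTopology G) (gdeltaTopology G) _).2 ?_
    intro a s hs
    obtain ⟨t, ht, hat, hts⟩ := mem_nhds_gdelta.1 hs
    exact mem_nhds_gdelta.2
      ⟨_, ht.preimage (continuous_inv (G := G)), hat, fun x hx => hts hx⟩

/-- A topological group `(G, τ)` is `G_δ`-complete if the topological group `(G, τ_δ)` is
(Raïkov-)complete. -/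
def IsGdeltaComplete (G : Type*) [Group G] [TopologicalSpace G] [IsTopologicalGroup G] : Prop :=
  @IsRaikovComplete G _ (gdeltaTopology G) (isTopologicalGroup_gdelta G)

/-! A pointwise limit of isometries whose inverses also converge pointwise is a bijective isometry,
so `X ≃ᵢ X` is complete for complete `X`. For arbitrary `X`, a Cauchy filter for the `G_δ`-topology
has eventually constant orbits, so the limit exists without completeness of `X`.

Conversely, take bounded group seminorms whose open unit balls lie in basic neighbourhoods of 1, and
a dense set `D`. `GaugeData.Space` is a union of copies of `G` (layers), on which `G` acts by left
translation. A rigid coloring, readable off the distances, forces an isometry `φ` to preserve every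
layer `inl p` and the union of the layers `inr S`. It could still act by unrelated elements on
different layers `inl p`; the layers `inr S` prevent this, because the image of one of their points
names a single group element that imitates `φ` on the layers `(n, S n)`.

In the quotient of `Space` by distance zero the imitation is exact on countably many layers (part
A); in its completion it is arbitrarily good on finitely many (part B). So the elements imitating
`φ` form a proper filter, which is Cauchy in the relevant sense, and its limit acts as `φ`
(`exists_smul_eq_of_isGdeltaComplete`, `exists_smul_eq_of_isRaikovComplete`). For the weight,
eventually constant sequences and `D` suffice for a dense set. -/

/-! ### Completeness through filters; isometry groups are complete. -/

section RaikovCompleteness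

open Filter

theorem isRaikovComplete_iff (G : Type*) [Group G] [TopologicalSpace G] [IsTopologicalGroup G] :
    IsRaikovComplete G ↔ ∀ F : Filter G, F.NeBot →
      (∀ U ∈ 𝓝 (1 : G), ∃ A ∈ F, ∀ a ∈ A, ∀ b ∈ A, a⁻¹ * b ∈ U ∧ b * a⁻¹ ∈ U) →
      ∃ g, F ≤ 𝓝 g := by
  let u : UniformSpace G :=
    IsTopologicalGroup.leftUniformSpace G ⊓ IsTopologicalGroup.rightUniformSpace G
  have hu : @uniformity G u = comap (fun p : G × G => p.1⁻¹ * p.2) (𝓝 1) ⊓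
      comap (fun p : G × G => p.2 * p.1⁻¹) (𝓝 1) := rfl
  have hn : ∀ g, @nhds G u.toTopologicalSpace g = 𝓝 g := fun g => by
    change @nhds G (_ ⊓ _) g = _
    rw [nhds_inf]
    exact inf_idem _
  have hc : ∀ F : Filter G, @Cauchy G u F ↔ F.NeBot ∧
      ∀ U ∈ 𝓝 (1 : G), ∃ A ∈ F, ∀ a ∈ A, ∀ b ∈ A, a⁻¹ * b ∈ U ∧ b * a⁻¹ ∈ U := by
    intro F
    unfold Cauchy
    rw [hu, le_inf_iff]
    refine and_congr_right fun _ => ⟨fun h U hU => ?_, fun h => ⟨?_, ?_⟩⟩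
    · obtain ⟨A, hA, hAU⟩ := mem_prod_same_iff.1 (h.1 (preimage_mem_comap hU))
      obtain ⟨B, hB, hBU⟩ := mem_prod_same_iff.1 (h.2 (preimage_mem_comap hU))
      exact ⟨A ∩ B, inter_mem hA hB, fun a ha b hb =>
        ⟨@hAU (a, b) ⟨ha.1, hb.1⟩, @hBU (a, b) ⟨ha.2, hb.2⟩⟩⟩
    all_goals
      rintro s ⟨U, hU, hUs⟩
      obtain ⟨A, hA, hAU⟩ := h U hU
      refine mem_prod_same_iff.2 ⟨A, hA, fun p hp => hUs ?_⟩
    exacts [(hAU _ hp.1 _ hp.2).1, (hAU _ hp.1 _ hp.2).2]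
  constructor
  · intro h F hF hU
    obtain ⟨g, hg⟩ := (@CompleteSpace.complete G u h) ((hc F).2 ⟨hF, hU⟩)
    exact ⟨g, hn g ▸ hg⟩
  · intro h
    refine @CompleteSpace.mk G u fun {F} hF => ?_
    obtain ⟨g, hg⟩ := h F ((hc F).1 hF).1 ((hc F).1 hF).2
    exact ⟨g, (hn g).symm ▸ hg⟩

theorem isGdeltaComplete_iff (G : Type*) [Group G] [TopologicalSpace G] [IsTopologicalGroup G] :
    IsGdeltaComplete G ↔ ∀ F : Filter G, F.NeBot →
      (∀ U : Set G, IsGδ U → 1 ∈ U → ∃ A ∈ F, ∀ a ∈ A, ∀ b ∈ A, a⁻¹ * b ∈ U ∧ b * a⁻¹ ∈ U) →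
      ∃ g, ∀ U : Set G, IsGδ U → g ∈ U → U ∈ F := by
  unfold IsGdeltaComplete
  refine (@isRaikovComplete_iff G _ (gdeltaTopology G) (isTopologicalGroup_gdelta G)).trans ?_
  refine forall_congr' fun F => forall_congr' fun _ => imp_congr ?_ (exists_congr fun g => ?_)
  · refine ⟨fun h U hU h1 => h U (mem_nhds_gdelta.2 ⟨U, hU, h1, subset_rfl⟩), fun h U hU => ?_⟩
    obtain ⟨t, ht, h1, htU⟩ := mem_nhds_gdelta.1 hU
    obtain ⟨A, hA, hAt⟩ := h t ht h1
    exact ⟨A, hA, fun a ha b hb => ⟨htU (hAt a ha b hb).1, htU (hAt a ha b hb).2⟩⟩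
  · refine ⟨fun h U hU hg => h (mem_nhds_gdelta.2 ⟨U, hU, hg, subset_rfl⟩), fun h U hU => ?_⟩
    obtain ⟨t, ht, h1, htU⟩ := mem_nhds_gdelta.1 hU
    exact mem_of_superset (h t ht h1) htU

/-- Two filters of maps, one converging pointwise to `f` and the other consisting of the inverses
and converging to `f'`, give rise to mutually inverse isometries. -/
theorem exists_isometryEquiv_of_tendsto {ι X : Type*} [MetricSpace X] {F : Filter ι} [F.NeBot]
    {e : ι → X ≃ᵢ X} (h : ∀ x, ∃ y, Tendsto (fun i => e i x) F (𝓝 y))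
    (h' : ∀ x, ∃ y, Tendsto (fun i => (e i)⁻¹ x) F (𝓝 y)) :
    ∃ f : X ≃ᵢ X, ∀ x, Tendsto (fun i => e i x) F (𝓝 (f x)) := by
  choose f hf using h
  choose f' hf' using h'
  have hiso : Isometry f := Isometry.of_dist_eq fun x y =>
    tendsto_nhds_unique ((hf x).dist (hf y)) (by simp only [IsometryEquiv.dist_eq, tendsto_const_nhds])
  have hr : ∀ x, f (f' x) = x := fun x => by
    refine tendsto_nhds_unique (hf (f' x)) (tendsto_iff_dist_tendsto_zero.2 ?_)
    refine (tendsto_iff_dist_tendsto_zero.1 (hf' x)).congr fun i => ?_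
    rw [dist_comm, ← (e i).dist_eq, IsometryEquiv.apply_inv_self, dist_comm]
  have hl : ∀ x, f' (f x) = x := fun x => hiso.injective (hr _)
  exact ⟨⟨⟨f, f', hl, hr⟩, hiso⟩, hf⟩

variable {G X : Type*} [Group G] [TopologicalSpace G] [MetricSpace X]

theorem continuous_apply_isometryEquiv (x : X) : Continuous fun f : X ≃ᵢ X => f x :=
  (continuous_apply x).comp continuous_induced_dom

theorem tendsto_nhds_of_apply {ι : Type*} (φ : G ≃ₜ* (X ≃ᵢ X)) {F : Filter ι} {e : ι → G} {g : G}
    (h : ∀ x, Tendsto (fun i => φ (e i) x) F (𝓝 (φ g x))) : Tendsto e F (𝓝 g) := by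
  have h1 : Tendsto (fun i => φ (e i)) F (𝓝 (φ g)) := by
    rw [nhds_induced, tendsto_comap_iff]
    exact tendsto_pi_nhds.2 h
  have h2 := (φ.symm.continuous_toFun.tendsto (φ g)).comp h1
  have h3 : φ.symm (φ g) = g := φ.symm_apply_apply g
  have h4 : ∀ i, φ.symm (φ (e i)) = e i := fun i => φ.symm_apply_apply _
  refine (h2.congr h4).trans ?_
  exact le_of_eq (congrArg 𝓝 h3)

/-- Smallness of `a⁻¹ * b` makes the orbits `g x` Cauchy, and smallness of `b * a⁻¹` does the same
for `g⁻¹ x`; both are needed for the limit to be bijective. -/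
theorem isRaikovComplete_of_isometryEquiv [IsTopologicalGroup G] [CompleteSpace X] (φ : G ≃ₜ* (X ≃ᵢ X)) :
    IsRaikovComplete G := by
  refine (isRaikovComplete_iff G).2 fun F hF hU => ?_
  have key : ∀ x : X, ∀ ε > 0, ∃ A ∈ F, ∀ a ∈ A, ∀ b ∈ A,
      dist (φ a x) (φ b x) < ε ∧ dist ((φ a)⁻¹ x) ((φ b)⁻¹ x) < ε := by
    intro x ε hε
    have hc : Continuous fun g => φ g x := (continuous_apply_isometryEquiv x).comp φ.continuous_toFun
    obtain ⟨A, hA, h⟩ := hU {g | dist (φ g x) x < ε} ((hc.dist continuous_const).continuousAt.eventually_lt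
      continuousAt_const (by simpa using hε))
    refine ⟨A, hA, fun a ha b hb => ⟨?_, ?_⟩⟩
    · have := (h a ha b hb).1
      rw [Set.mem_ofPred_eq, map_mul, map_inv, IsometryEquiv.mul_apply] at this
      rwa [dist_comm, ← (φ a)⁻¹.dist_eq, IsometryEquiv.inv_apply_self]
    · have := (h a ha b hb).2
      rw [Set.mem_ofPred_eq, map_mul, map_inv, IsometryEquiv.mul_apply] at this
      rwa [← (φ b).dist_eq, IsometryEquiv.apply_inv_self]
  obtain ⟨f, hf⟩ : ∃ f : X ≃ᵢ X, ∀ x, Tendsto (fun g => φ g x) F (𝓝 (f x)) := by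
    refine exists_isometryEquiv_of_tendsto (fun x => ?_) fun x => ?_
    all_goals
      refine cauchy_map_iff_exists_tendsto.1 (Metric.cauchy_iff.2 ⟨hF.map _, fun ε hε => ?_⟩)
      obtain ⟨A, hA, h⟩ := key x ε hε
      refine ⟨_, image_mem_map hA, ?_⟩
      rintro _ ⟨a, ha, rfl⟩ _ ⟨b, hb, rfl⟩
    exacts [(h a ha b hb).1, (h a ha b hb).2]
  exact ⟨φ.symm f, tendsto_nhds_of_apply φ (e := id) (g := φ.symm f) fun x => by simpa using hf x⟩

/-- The pointwise stabilizer of a countable set is a `G_δ`, so a Cauchy filter is eventually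
constant on each countable set of points. Membership in a `G_δ`-neighbourhood of the limit is in
turn secured by the values at countably many points. -/
theorem isGdeltaComplete_of_isometryEquiv [IsTopologicalGroup G] (φ : G ≃ₜ* (X ≃ᵢ X)) : IsGdeltaComplete G := by
  refine (isGdeltaComplete_iff G).2 fun F hF hU => ?_
  have hGδ : ∀ (C : Set X), C.Countable → IsGδ {g | ∀ x ∈ C, φ g x = x} := by
    intro C hC
    simp only [Set.ofPred_forall]
    exact IsGδ.biInter hC fun x _ => (isClosed_singleton (x := x)).isGδ.preimage
      ((continuous_apply_isometryEquiv x).comp φ.continuous_toFun)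
  have key : ∀ C : Set X, C.Countable → ∃ A ∈ F, ∀ a ∈ A, ∀ b ∈ A, ∀ x ∈ C,
      φ a x = φ b x ∧ (φ a)⁻¹ x = (φ b)⁻¹ x := by
    intro C hC
    obtain ⟨A, hA, h⟩ := hU _ (hGδ C hC) (by simp)
    refine ⟨A, hA, fun a ha b hb x hx => ⟨?_, ?_⟩⟩
    · have := (h b hb a ha).1 x hx
      rw [map_mul, map_inv, IsometryEquiv.mul_apply] at this
      rw [← (φ b).apply_inv_self (φ a x), this]
    · have := (h a ha b hb).2 x hx
      rw [map_mul, map_inv, IsometryEquiv.mul_apply] at this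
      rw [← (φ b).inv_apply_self ((φ a)⁻¹ x), this]
  obtain ⟨f, hf⟩ : ∃ f : X ≃ᵢ X, ∀ x, Tendsto (fun g => φ g x) F (𝓝 (f x)) := by
    refine exists_isometryEquiv_of_tendsto (fun x => ?_) fun x => ?_
    all_goals
      obtain ⟨A, hA, h⟩ := key {x} (Set.countable_singleton x)
      obtain ⟨a, ha⟩ := hF.nonempty_of_mem hA
    · exact ⟨φ a x, tendsto_nhds_of_eventually_eq (mem_of_superset hA fun b hb => (h b hb a ha x rfl).1)⟩
    · exact ⟨_, tendsto_nhds_of_eventually_eq (mem_of_superset hA fun b hb => (h b hb a ha x rfl).2)⟩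
  refine ⟨φ.symm f, fun U hUδ hfU => ?_⟩
  obtain ⟨V, hVo, rfl⟩ := isGδ_iff_eq_iInter_nat.1 hUδ
  have hV : ∀ n, ∃ s : Finset X, ∀ g, (∀ x ∈ s, φ g x = f x) → g ∈ V n := by
    intro n
    have h1 : φ.symm ⁻¹' V n ∈ 𝓝 f :=
      ((hVo n).preimage φ.symm.continuous_toFun).mem_nhds (Set.mem_iInter.1 hfU n)
    rw [nhds_induced, mem_comap] at h1
    obtain ⟨t, ht, htV⟩ := h1
    rw [nhds_pi, Filter.mem_pi] at ht
    obtain ⟨I, hI, W, hW, hWt⟩ := ht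
    refine ⟨hI.toFinset, fun g hg => ?_⟩
    have : φ.symm (φ g) ∈ V n := htV (hWt fun x hx => by
      change φ g x ∈ W x
      rw [hg x (hI.mem_toFinset.2 hx)]
      exact mem_of_mem_nhds (hW x))
    rwa [show φ.symm (φ g) = g from φ.symm_apply_apply g] at this
  choose s hs using hV
  obtain ⟨A, hA, h⟩ := key (⋃ n, s n) (Set.countable_iUnion fun n => (s n).countable_toSet)
  refine mem_of_superset hA fun a ha => Set.mem_iInter.2 fun n => hs n a fun x hx => ?_
  refine tendsto_nhds_unique (tendsto_nhds_of_eventually_eq ?_) (hf x)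
  exact mem_of_superset hA fun b hb =>
    (h b hb a ha x (Set.mem_iUnion.2 ⟨n, hx⟩)).1

end RaikovCompleteness

/-! ### Group seminorms from neighbourhoods of the identity. -/

section Seminorms

open Filter Pointwise

/-- Birkhoff–Kakutani: a chain of neighbourhoods, each with products and inverses inside the
previous one, generates a countably generated uniformity, hence a pseudometric. -/
theorem exists_groupSeminorm_lt_one_subset {G : Type*} [Group G] [TopologicalSpace G]
    [IsTopologicalGroup G] {U : Set G} (hU : U ∈ 𝓝 1) :
    ∃ N : GroupSeminorm G, (∀ g, N g ≤ 1) ∧ Tendsto N (𝓝 1) (𝓝 0) ∧ ∀ g, N g < 1 → g ∈ U := by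
  have step : ∀ V : {V : Set G // V ∈ 𝓝 1}, ∃ W : {V : Set G // V ∈ 𝓝 1},
      (∀ a ∈ W.1, a⁻¹ ∈ V.1) ∧ ∀ a ∈ W.1, ∀ b ∈ W.1, a * b ∈ V.1 := by
    rintro ⟨V, hV⟩
    obtain ⟨W, hW, h⟩ := exists_nhds_one_split hV
    have hi : {a : G | a⁻¹ ∈ V} ∈ 𝓝 1 := by
      have := (continuous_inv (G := G)).tendsto 1
      rw [inv_one] at this
      exact this hV
    exact ⟨⟨W ∩ _, inter_mem hW hi⟩, fun a ha => ha.2, fun a ha b hb => h a ha.1 b hb.1⟩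
  choose s hsi hsm using step
  let V : ℕ → {V : Set G // V ∈ 𝓝 1} := fun n => s^[n] ⟨U, hU⟩
  have hVs : ∀ n, V (n + 1) = s (V n) := fun n => Function.iterate_succ_apply' _ _ _
  have h1 : ∀ n, (1 : G) ∈ (V n).1 := fun n => mem_of_mem_nhds (V n).2
  have hanti : Antitone fun n => (V n).1 := antitone_nat_of_succ_le fun n a ha => by
    rw [hVs] at ha
    simpa using hsm (V n) a ha 1 (mem_of_mem_nhds (s (V n)).2)
  let f : Filter G := ⨅ n, 𝓟 (V n).1
  have hf : f.HasBasis (fun _ => True) fun n => (V n).1 := hasBasis_iInf_principal hanti.directed_ge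
  let c : UniformSpace.Core G :=
    { uniformity := comap (fun p : G × G => p.1⁻¹ * p.2) f
      refl := by
        intro r hr
        obtain ⟨n, -, hn⟩ := (hf.comap _).mem_iff.1 hr
        rintro ⟨a, b⟩ hab
        obtain rfl : a = b := hab
        exact hn (by simpa using h1 n)
      symm := by
        refine ((hf.comap _).tendsto_iff (hf.comap _)).2 fun n _ => ⟨n + 1, trivial, ?_⟩
        rintro ⟨a, b⟩ hab
        rw [Set.mem_preimage, hVs] at hab
        simpa using hsi _ _ hab
      comp := by
        refine (((hf.comap _).lift' (monotone_id.relComp monotone_id)).le_basis_iff (hf.comap _)).2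
          fun n _ => ⟨n + 1, trivial, ?_⟩
        rintro ⟨a, b⟩ ⟨z, haz, hzb⟩
        simp only [id, Set.mem_preimage, hVs] at haz hzb
        simpa [mul_assoc] using hsm _ _ haz _ hzb }
  let u : UniformSpace G := UniformSpace.ofCore c
  have hub : (uniformity G).HasBasis (fun _ => True)
      fun n => (fun p : G × G => p.1⁻¹ * p.2) ⁻¹' (V n).1 := hf.comap _
  have : (uniformity G).IsCountablyGenerated := HasCountableBasis.isCountablyGenerated
    ⟨hub, Set.to_countable _⟩
  obtain ⟨I, hI⟩ := UniformSpace.metrizable_uniformity G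
  have hdist : (uniformity G).HasBasis (fun ε : ℝ => 0 < ε) fun ε => {p : G × G | I.dist p.1 p.2 < ε} := by
    have := @Metric.uniformity_basis_dist G I
    rwa [hI] at this
  obtain ⟨d, hself, hsymm, htri, hsmall, ε, hε, hbig⟩ : ∃ d : G → G → ℝ, (∀ a, d a a = 0) ∧
      (∀ a b, d a b = d b a) ∧ (∀ a b c, d a c ≤ d a b + d b c) ∧
      (∀ ε > 0, ∃ n, ∀ a b, a⁻¹ * b ∈ (V n).1 → d a b < ε) ∧
      ∃ ε > 0, ∀ a b, d a b < ε → a⁻¹ * b ∈ U := by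
    refine ⟨I.dist, I.dist_self, I.dist_comm, I.dist_triangle, fun ε hε => ?_, ?_⟩
    · obtain ⟨n, -, hn⟩ := hub.mem_iff.1 (hdist.mem_of_mem hε)
      exact ⟨n, fun a b hab => @hn (a, b) hab⟩
    · obtain ⟨ε, hε, h⟩ := hdist.mem_iff.1 (hub.mem_of_mem (i := 0) trivial)
      exact ⟨ε, hε, fun a b hab => @h (a, b) hab⟩
  clear_value V
  have hnn : ∀ a b, 0 ≤ d a b := fun a b => by linarith [htri a b a, hself a, hsymm a b]
  -- Truncation bounds the pseudometric, so that the supremum over left translates, which produces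
  -- the seminorm, is finite; scaling by `ε` turns the bound `N g < 1` into `d 1 g < ε`.
  let e : G → G → ℝ := fun a b => min 1 (d a b / ε)
  have he0 : ∀ a b, 0 ≤ e a b := fun a b => le_min zero_le_one (div_nonneg (hnn a b) hε.le)
  have hetri : ∀ a b c, e a c ≤ e a b + e b c := by
    intro a b c
    have h1 : d a c / ε ≤ d a b / ε + d b c / ε := by
      rw [← add_div]
      exact div_le_div_of_nonneg_right (htri a b c) hε.le
    have h2 := div_nonneg (hnn a b) hε.le
    have h3 := div_nonneg (hnn b c) hε.le
    simp only [e]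
    rcases min_cases 1 (d a b / ε) with h | h <;> rcases min_cases 1 (d b c / ε) with h' | h' <;>
      rw [h.1, h'.1]
    exacts [(min_le_left _ _).trans (by linarith), (min_le_left _ _).trans (by linarith),
      (min_le_left _ _).trans (by linarith), (min_le_right _ _).trans h1]
  have hbdd : ∀ g, BddAbove (Set.range fun k => e k (k * g)) := fun g =>
    ⟨1, by rintro _ ⟨k, rfl⟩; exact min_le_left _ _⟩
  have hle : ∀ g k, e k (k * g) ≤ ⨆ k, e k (k * g) := fun g => le_ciSup (hbdd g)
  refine ⟨⟨fun g => ⨆ k, e k (k * g), ?_, fun g h => ciSup_le fun k => ?_, ?_⟩,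
    fun g => ciSup_le fun k => min_le_left _ _, ?_, fun g hg => ?_⟩
  · simp [e, hself]
  · refine (hetri k (k * g) (k * (g * h))).trans (add_le_add (hle g k) ?_)
    rw [← mul_assoc]
    exact hle h (k * g)
  · have : ∀ g, ⨆ k, e k (k * g⁻¹) ≤ ⨆ k, e k (k * g) := fun g => ciSup_le fun k => by
      refine le_trans (le_of_eq ?_) (hle g (k * g⁻¹))
      simp only [e, inv_mul_cancel_right]
      rw [hsymm]
    exact fun g => le_antisymm (this g) (by simpa using this g⁻¹)
  · refine Metric.tendsto_nhds.2 fun δ hδ => ?_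
    obtain ⟨n, hn⟩ := hsmall (δ / 2 * ε) (by positivity)
    filter_upwards [(V n).2] with g hg
    rw [Real.dist_0_eq_abs]
    change |⨆ k, e k (k * g)| < δ
    rw [abs_of_nonneg ((he0 1 (1 * g)).trans (hle g 1))]
    refine lt_of_le_of_lt (ciSup_le fun k => (min_le_right _ _).trans ?_) (half_lt_self hδ)
    rw [div_le_iff₀ hε]
    exact (hn _ _ (by simpa using hg)).le
  · have h2 : e 1 (1 * g) < 1 := (hle g 1).trans_lt hg
    have h3 : d 1 g / ε < 1 := by simpa [e] using h2
    simpa using hbig 1 g ((div_lt_one hε).1 h3)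

end Seminorms

/-! ### A rigid coloring from a well-order. -/

section RigidColoring

/-- The complete graph on an infinite set has a finite edge coloring without nontrivial
automorphisms. -/
theorem exists_rigid_coloring (R : Type*) [Infinite R] : ∃ c : R → R → ℕ, (∀ x, c x x = 0) ∧
    (∀ x y, c x y = c y x) ∧ (∀ x y, x ≠ y → 4 ≤ c x y) ∧ (∀ x y, c x y ≤ 7) ∧
    ∀ σ : Equiv.Perm R, (∀ x y, c (σ x) (σ y) = c x y) → ∀ x, σ x = x := by
  classical
  obtain ⟨E⟩ : Nonempty (R ≃ R ⊕ R) := Cardinal.eq.1 (by simp)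
  obtain ⟨_, _⟩ := exists_wellFoundedLT R
  -- Colors 4 and 5 tell the two halves apart, and 6 against 7 records a well-order across them. An
  -- automorphism thus induces an order automorphism of a well-order, which is the identity.
  let c : R ⊕ R → R ⊕ R → ℕ
    | .inl a, .inl b => if a = b then 0 else 4
    | .inr a, .inr b => if a = b then 0 else 5
    | .inl a, .inr b => if a < b then 6 else 7
    | .inr b, .inl a => if a < b then 6 else 7
  have hrigid : ∀ σ : Equiv.Perm (R ⊕ R), (∀ x y, c (σ x) (σ y) = c x y) → ∀ x, σ x = x := by
    intro σ hσ
    have hl : ∀ a, ∃ b, σ (.inl a) = .inl b := by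
      intro a
      obtain ⟨b, hb⟩ := exists_ne a
      have := hσ (.inl a) (.inl b)
      rcases h : σ (.inl a) with x | x <;> rcases h' : σ (.inl b) with y | y <;> grind
    have hr : ∀ a, ∃ b, σ (.inr a) = .inr b := by
      intro a
      obtain ⟨b, hb⟩ := exists_ne a
      have := hσ (.inr a) (.inr b)
      rcases h : σ (.inr a) with x | x <;> rcases h' : σ (.inr b) with y | y <;> grind
    choose s hs using hl
    choose t ht using hr
    have hst : ∀ a b, s a < t b ↔ a < b := by
      intro a b
      have := hσ (.inl a) (.inr b)
      rw [hs, ht] at this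
      grind
    have hssurj : Function.Surjective s := by
      intro b
      rcases h : σ.symm (.inl b) with x | x
      · exact ⟨x, by simpa [hs] using (σ.symm_apply_eq.1 h).symm⟩
      · simpa [ht] using σ.symm_apply_eq.1 h
    have htsurj : Function.Surjective t := by
      intro b
      rcases h : σ.symm (.inr b) with x | x
      · simpa [hs] using σ.symm_apply_eq.1 h
      · exact ⟨x, by simpa [ht] using (σ.symm_apply_eq.1 h).symm⟩
    have hsinj : Function.Injective s := fun a b hab => by
      simpa using σ.injective ((hs a).trans ((congrArg _ hab).trans (hs b).symm))
    have hmono : StrictMono s := by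
      refine Monotone.strictMono_of_injective (fun a a' haa => ?_) hsinj
      by_contra! h
      obtain ⟨b, hb⟩ := htsurj (s a)
      have h1 := (hst a' b).1 (hb ▸ h)
      have h2 := (hst a b).2 (haa.trans_lt h1)
      exact (hb ▸ h2).false
    have hsid : ∀ a, s a = a := by
      intro a
      refine le_antisymm ?_ hmono.le_apply
      have := (hmono.orderIsoOfSurjective s hssurj).symm.strictMono.le_apply (x := s a)
      rwa [show s a = hmono.orderIsoOfSurjective s hssurj a from rfl,
        OrderIso.symm_apply_apply] at this
    have htid : ∀ b, t b = b := by
      intro b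
      refine eq_of_forall_lt_iff fun a => ?_
      rw [← hst a b, hsid]
    rintro (a | a)
    · rw [hs, hsid]
    · rw [ht, htid]
  refine ⟨fun x y => c (E x) (E y), fun x => ?_, fun x y => ?_, fun x y hxy => ?_, fun x y => ?_,
    fun σ hσ x => ?_⟩
  · rcases h : E x with a | a <;> grind
  · rcases h : E x with a | a <;> rcases h' : E y with b | b <;> grind
  · have : E x ≠ E y := E.injective.ne hxy
    rcases h : E x with a | a <;> rcases h' : E y with b | b <;> grind
  · rcases h : E x with a | a <;> rcases h' : E y with b | b <;> grind
  · have := hrigid ((E.symm.trans σ).trans E) (fun x y => by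
      simpa using hσ (E.symm x) (E.symm y)) (E x)
    simpa using this

end RigidColoring

/-! ### The layered space and its pseudometric. -/

/-- The data from which the metric space of a group is built: a family of bounded group seminorms,
a set of elements of the group, and a rigid edge coloring of the set of labels. -/
structure GaugeData (G : Type u) [Group G] where
  I : Type u
  D : Set G
  N : I → GroupSeminorm G
  N_le_one : ∀ i g, N i g ≤ 1
  c : Option (ℕ × I × D) → Option (ℕ × I × D) → ℕ
  c_self : ∀ r, c r r = 0
  c_comm : ∀ r s, c r s = c s r
  four_le_c : ∀ r s, r ≠ s → 4 ≤ c r s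
  c_le_seven : ∀ r s, c r s ≤ 7
  c_rigid : ∀ σ : Equiv.Perm (Option (ℕ × I × D)), (∀ r s, c (σ r) (σ s) = c r s) → ∀ r, σ r = r

namespace GaugeData

open Filter

variable {G : Type u} [Group G] (𝒟 : GaugeData G)

abbrev K : Type u := 𝒟.I × 𝒟.D

/-- The layers `inl (n, k)` each carry one seminorm, scaled by `2⁻ⁿ`; the layers `inr S` link `(0, S
0), (1, S 1), …` to each other. -/
abbrev Idx : Type u := (ℕ × 𝒟.K) ⊕ (ℕ → 𝒟.K)

variable {𝒟}

/-- All indices that are infinite sequences share the label `none`. -/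
def lab : 𝒟.Idx → Option (ℕ × 𝒟.K)
  | .inl p => some p
  | .inr _ => none

/-- A layer is a word with possible blanks. Since `inl (n, k)` is blank off position `n`, its
distance to `inr S` compares `k` with `S n` only, all other terms being constant. -/
def seq : 𝒟.Idx → ℕ → Option 𝒟.K
  | .inl p, m => if m = p.1 then some p.2 else none
  | .inr S, m => some (S m)

def ρ (i : 𝒟.I) (g h : G) : ℝ := 𝒟.N i (g⁻¹ * h)

theorem ρ_self (i : 𝒟.I) (g : G) : ρ i g g = 0 := by simp [ρ]

theorem ρ_nonneg (i : 𝒟.I) (g h : G) : 0 ≤ ρ i g h := apply_nonneg _ _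

theorem ρ_le_one (i : 𝒟.I) (g h : G) : ρ i g h ≤ 1 := 𝒟.N_le_one _ _

theorem ρ_comm (i : 𝒟.I) (g h : G) : ρ i g h = ρ i h g := by
  rw [ρ, ← map_inv_eq_map]
  simp [ρ]

theorem ρ_triangle (i : 𝒟.I) (g h k : G) : ρ i g k ≤ ρ i g h + ρ i h k := by
  simpa [ρ, mul_assoc] using map_mul_le_add (𝒟.N i) (g⁻¹ * h) (h⁻¹ * k)

theorem ρ_mul_left (i : 𝒟.I) (u g h : G) : ρ i (u * g) (u * h) = ρ i g h := by
  simp [ρ, mul_assoc]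

open Classical in
-- The offset 1 between distinct letters makes a value below 1 force equality. Letters with the same
-- seminorm and different elements of `D` still compare their translated points, which ties those
-- layers together.
noncomputable def dW : Option 𝒟.K → G → Option 𝒟.K → G → ℝ
  | none, _, none, _ => 0
  | none, _, some _, _ => 2
  | some _, _, none, _ => 2
  | some k, g, some l, h =>
    (if k = l then 0 else 1) + (if k.1 = l.1 then ρ k.1 (g * k.2) (h * l.2) else 1)

theorem dW_none_some (g : G) (k : 𝒟.K) (h : G) : dW none g (some k) h = 2 := rfl

theorem dW_some_none (g : G) (k : 𝒟.K) (h : G) : dW (some k) g none h = 2 := rfl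

theorem dW_none_none (g : G) (h : G) : dW (none : Option 𝒟.K) g none h = 0 := rfl

theorem dW_some_self (g : G) (k : 𝒟.K) (h : G) :
    dW (some k) g (some k) h = ρ k.1 (g * k.2) (h * k.2) := by simp [dW]

theorem eq_of_dW_lt_one {k l : 𝒟.K} {g h : G} (hd : dW (some k) g (some l) h < 1) : k = l := by
  by_contra hkl
  have := ρ_nonneg k.1 (g * k.2) (h * l.2)
  simp only [dW, if_neg hkl] at hd
  split_ifs at hd <;> linarith

theorem dW_self (x : Option 𝒟.K) (g : G) : dW x g x g = 0 := by
  cases x <;> simp [dW, ρ_self]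

theorem dW_comm (x : Option 𝒟.K) (g : G) (y : Option 𝒟.K) (h : G) : dW x g y h = dW y h x g := by
  rcases x with _ | k <;> rcases y with _ | l <;> try rfl
  obtain ⟨i, a⟩ := k
  obtain ⟨j, b⟩ := l
  by_cases hij : i = j
  · subst hij
    by_cases hab : a = b
    · subst hab
      simp [dW, ρ_comm i (g * a)]
    · simp [dW, hab, Ne.symm hab, ρ_comm i (g * a)]
  · simp [dW, hij, Ne.symm hij]

theorem dW_nonneg (x : Option 𝒟.K) (g : G) (y : Option 𝒟.K) (h : G) : 0 ≤ dW x g y h := by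
  rcases x with _ | k <;> rcases y with _ | l <;> simp only [dW] <;> try norm_num
  have := ρ_nonneg k.1 (g * k.2) (h * l.2)
  split_ifs <;> linarith

theorem dW_le_two (x : Option 𝒟.K) (g : G) (y : Option 𝒟.K) (h : G) : dW x g y h ≤ 2 := by
  rcases x with _ | k <;> rcases y with _ | l <;> simp only [dW] <;> try norm_num
  have := ρ_le_one k.1 (g * k.2) (h * l.2)
  split_ifs <;> linarith

open Classical in
theorem dW_triangle (x : Option 𝒟.K) (g : G) (y : Option 𝒟.K) (h : G) (z : Option 𝒟.K) (k : G) :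
    dW x g z k ≤ dW x g y h + dW y h z k := by
  have h1 := dW_nonneg x g y h
  have h2 := dW_nonneg y h z k
  have h3 := dW_le_two x g z k
  rcases x with _ | ⟨i, a⟩ <;> rcases y with _ | ⟨j, b⟩ <;> rcases z with _ | ⟨l, d⟩ <;>
    try simp only [dW_none_some, dW_some_none, dW_none_none] at * <;> linarith
  simp only [dW]
  have hK : (if (i, a) = (l, d) then (0 : ℝ) else 1) ≤
      (if (i, a) = (j, b) then 0 else 1) + (if (j, b) = (l, d) then 0 else 1) := by
    split_ifs <;> simp_all
  have hP : (if i = l then ρ i (g * a) (k * d) else 1) ≤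
      (if i = j then ρ i (g * a) (h * b) else 1) + (if j = l then ρ j (h * b) (k * d) else 1) := by
    have n1 := ρ_nonneg i (g * a) (h * b)
    have n2 := ρ_nonneg j (h * b) (k * d)
    have n3 := ρ_le_one i (g * a) (k * d)
    by_cases hij : i = j
    · subst hij
      by_cases hil : i = l
      · subst hil
        simpa using ρ_triangle i _ _ _
      · simpa [hil] using n1
    · rw [if_neg hij]
      split_ifs <;> linarith
  linarith

theorem dW_mul_left (u : G) (x : Option 𝒟.K) (g : G) (y : Option 𝒟.K) (h : G) :
    dW x (u * g) y (u * h) = dW x g y h := by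
  rcases x with _ | k <;> rcases y with _ | l <;> simp [dW, mul_assoc, ρ_mul_left]

theorem summable_dW (x y : ℕ → Option 𝒟.K) (g h : G) :
    Summable fun n => (1 / 2 : ℝ) ^ n * dW (x n) g (y n) h := by
  refine Summable.of_nonneg_of_le (fun n => mul_nonneg (by positivity) (dW_nonneg _ _ _ _))
    (fun n => mul_le_mul_of_nonneg_left (dW_le_two _ _ _ _) (by positivity))
    (summable_geometric_two.mul_right 2)

noncomputable def dSeq (x : ℕ → Option 𝒟.K) (g : G) (y : ℕ → Option 𝒟.K) (h : G) : ℝ :=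
  ∑' n, (1 / 2 : ℝ) ^ n * dW (x n) g (y n) h

theorem dSeq_nonneg (x : ℕ → Option 𝒟.K) (g : G) (y : ℕ → Option 𝒟.K) (h : G) :
    0 ≤ dSeq x g y h :=
  tsum_nonneg fun n => mul_nonneg (by positivity) (dW_nonneg _ _ _ _)

theorem dSeq_le_four (x : ℕ → Option 𝒟.K) (g : G) (y : ℕ → Option 𝒟.K) (h : G) :
    dSeq x g y h ≤ 4 := by
  have h2 : ∑' n : ℕ, (1 / 2 : ℝ) ^ n * 2 = 4 := by
    rw [tsum_mul_right, tsum_geometric_two]; norm_num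
  rw [← h2]
  exact (summable_dW _ _ _ _).tsum_le_tsum
    (fun n => mul_le_mul_of_nonneg_left (dW_le_two _ _ _ _) (by positivity))
    (summable_geometric_two.mul_right 2)

theorem dSeq_sub_dSeq {x x' y y' : ℕ → Option 𝒟.K} {g g' h h' : G} (n : ℕ)
    (H : ∀ m ≠ n, dW (x m) g (y m) h = dW (x' m) g' (y' m) h') :
    dSeq x g y h - dSeq x' g' y' h' =
      (1 / 2 : ℝ) ^ n * (dW (x n) g (y n) h - dW (x' n) g' (y' n) h') := by
  rw [dSeq, dSeq, ← (summable_dW _ _ _ _).tsum_sub (summable_dW _ _ _ _), tsum_eq_single n, mul_sub]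
  intro m hm
  rw [H m hm, sub_self]

theorem dSeq_triangle (x : ℕ → Option 𝒟.K) (g : G) (y : ℕ → Option 𝒟.K) (h : G)
    (z : ℕ → Option 𝒟.K) (k : G) : dSeq x g z k ≤ dSeq x g y h + dSeq y h z k := by
  rw [dSeq, dSeq, dSeq, ← (summable_dW _ _ _ _).tsum_add (summable_dW _ _ _ _)]
  refine (summable_dW _ _ _ _).tsum_le_tsum (fun n => ?_)
    ((summable_dW _ _ _ _).add (summable_dW _ _ _ _))
  rw [← mul_add]
  exact mul_le_mul_of_nonneg_left (dW_triangle _ _ _ _ _ _) (by positivity)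

variable (𝒟) in
/-- The disjoint union of copies of `G`, one for each index. -/
@[ext]
structure Space where
  idx : 𝒟.Idx
  pt : G

/-- Two nonzero colors add up to at least 8, above the maximal color 7. -/
theorem c_triangle (r s t : Option (ℕ × 𝒟.K)) : 𝒟.c r t ≤ 𝒟.c r s + 𝒟.c s t := by
  by_cases h : r = s
  · simp [h, 𝒟.c_self]
  by_cases h' : s = t
  · simp [h', 𝒟.c_self]
  have := 𝒟.four_le_c _ _ h
  have := 𝒟.four_le_c _ _ h'
  have := 𝒟.c_le_seven r t
  lia

noncomputable instance : PseudoMetricSpace 𝒟.Space where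
  dist x y := 8 * 𝒟.c (lab x.idx) (lab y.idx) + dSeq (seq x.idx) x.pt (seq y.idx) y.pt
  dist_self x := by simp [𝒟.c_self, dSeq, dW_self]
  dist_comm x y := by
    rw [𝒟.c_comm]
    simp only [dSeq, dW_comm (seq x.idx _)]
  dist_triangle x y z := by
    have h1 := c_triangle (lab x.idx) (lab y.idx) (lab z.idx)
    have h2 := dSeq_triangle (seq x.idx) x.pt (seq y.idx) y.pt (seq z.idx) z.pt
    have h3 : (𝒟.c (lab x.idx) (lab z.idx) : ℝ) ≤
      𝒟.c (lab x.idx) (lab y.idx) + 𝒟.c (lab y.idx) (lab z.idx) := by exact_mod_cast h1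
    linarith

theorem dist_eq (x y : 𝒟.Space) : dist x y =
    8 * 𝒟.c (lab x.idx) (lab y.idx) + dSeq (seq x.idx) x.pt (seq y.idx) y.pt := rfl

instance : MulAction G 𝒟.Space where
  smul g x := ⟨x.idx, g * x.pt⟩
  one_smul _ := Space.ext rfl (one_mul _)
  mul_smul _ _ _ := Space.ext rfl (mul_assoc _ _ _)

theorem smul_mk (g : G) (a : 𝒟.Idx) (h : G) : g • (⟨a, h⟩ : 𝒟.Space) = ⟨a, g * h⟩ := rfl

instance : IsIsometricSMul G 𝒟.Space where
  isometry_smul g := Isometry.of_dist_eq fun ⟨a, x⟩ ⟨b, y⟩ => by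
    simp only [dist_eq, smul_mk, dSeq, dW_mul_left]

theorem seq_inl_of_ne {n m : ℕ} (h : m ≠ n) (k : 𝒟.K) : seq (.inl (n, k)) m = none := if_neg h

theorem seq_inl_self (n : ℕ) (k : 𝒟.K) : seq (.inl (n, k)) n = some k := if_pos rfl

theorem dist_inl_sub_dist_inl (n : ℕ) (k l : 𝒟.K) (g h g' h' : G) :
    dist (⟨.inl (n, k), g⟩ : 𝒟.Space) ⟨.inl (n, l), h⟩ - dist (⟨.inl (n, k), g'⟩ : 𝒟.Space)
      ⟨.inl (n, l), h'⟩ =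
      (1 / 2 : ℝ) ^ n * (dW (some k) g (some l) h - dW (some k) g' (some l) h') := by
  have := dSeq_sub_dSeq (x := seq (.inl (n, k))) (y := seq (.inl (n, l)))
    (x' := seq (.inl (n, k))) (y' := seq (.inl (n, l))) (g := g) (h := h) (g' := g') (h' := h') n
    fun m hm => by simp [seq_inl_of_ne hm, dW_none_none]
  simp only [seq_inl_self] at this
  simp only [dist_eq]
  linarith

theorem dist_inl (n : ℕ) (k : 𝒟.K) (g h : G) :
    dist (⟨.inl (n, k), g⟩ : 𝒟.Space) ⟨.inl (n, k), h⟩ =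
      (1 / 2 : ℝ) ^ n * ρ k.1 (g * k.2) (h * k.2) := by
  have := dist_inl_sub_dist_inl n k k g h g g
  rwa [dist_self, sub_zero, dW_self, sub_zero, dW_some_self] at this

theorem dist_inr_inl_sub (S S' : ℕ → 𝒟.K) (n : ℕ) (k : 𝒟.K) (g h g' h' : G) :
    dist (⟨.inr S, g⟩ : 𝒟.Space) ⟨.inl (n, k), h⟩ - dist (⟨.inr S', g'⟩ : 𝒟.Space)
      ⟨.inl (n, k), h'⟩ =
      (1 / 2 : ℝ) ^ n * (dW (some (S n)) g (some k) h - dW (some (S' n)) g' (some k) h') := by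
  have := dSeq_sub_dSeq (x := seq (.inr S)) (y := seq (.inl (n, k)))
    (x' := seq (.inr S')) (y' := seq (.inl (n, k))) (g := g) (h := h) (g' := g') (h' := h') n
    fun m hm => by rw [seq_inl_of_ne hm]; rfl
  rw [seq_inl_self] at this
  simp only [dist_eq]
  simp only [seq, lab] at *
  linarith

theorem dist_inr (S S' : ℕ → 𝒟.K) (g h : G) :
    dist (⟨.inr S, g⟩ : 𝒟.Space) ⟨.inr S', h⟩ =
      ∑' n, (1 / 2 : ℝ) ^ n * dW (some (S n)) g (some (S' n)) h := by
  simp [dist_eq, lab, 𝒟.c_self, dSeq, seq]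

end GaugeData

/-! ### Isometries preserve labels and act coherently on layers. -/

namespace GaugeData

open Filter

variable {G : Type u} [Group G] {𝒟 : GaugeData G} {X : Type v} [MetricSpace X] {ι : 𝒟.Space → X}

/-- The sequence part lies in `[0, 4]`, so an error below 4 changes `8 * c` by less than 8. -/
theorem c_eq_c_of_dist_lt {x y x' y' : 𝒟.Space} (h : |dist x y - dist x' y'| < 4) :
    𝒟.c (lab x.idx) (lab y.idx) = 𝒟.c (lab x'.idx) (lab y'.idx) := by
  rw [dist_eq, dist_eq, abs_lt] at h
  have h1 := dSeq_nonneg (seq x.idx) x.pt (seq y.idx) y.pt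
  have h2 := dSeq_nonneg (seq x'.idx) x'.pt (seq y'.idx) y'.pt
  have h3 := dSeq_le_four (seq x.idx) x.pt (seq y.idx) y.pt
  have h4 := dSeq_le_four (seq x'.idx) x'.pt (seq y'.idx) y'.pt
  have h5 : (𝒟.c (lab x.idx) (lab y.idx) : ℝ) < 𝒟.c (lab x'.idx) (lab y'.idx) + 1 := by linarith
  have h6 : (𝒟.c (lab x'.idx) (lab y'.idx) : ℝ) < 𝒟.c (lab x.idx) (lab y.idx) + 1 := by linarith
  norm_cast at h5 h6
  lia

theorem eq_of_c_eq_zero {r s : Option (ℕ × 𝒟.K)} (h : 𝒟.c r s = 0) : r = s := by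
  by_contra hrs
  have := 𝒟.four_le_c _ _ hrs
  lia

theorem abs_dist_sub_dist_le (hι : Isometry ι) (φ : X ≃ᵢ X) {x y x' y' : 𝒟.Space} {a b : ℝ}
    (hx : dist (φ (ι x)) (ι x') ≤ a) (hy : dist (φ (ι y)) (ι y') ≤ b) :
    |dist x' y' - dist x y| ≤ a + b := by
  rw [← hι.dist_eq, ← hι.dist_eq x y, ← φ.dist_eq (ι x), abs_le]
  have h1 := dist_triangle4 (ι x') (φ (ι x)) (φ (ι y)) (ι y')
  have h2 := dist_triangle4 (φ (ι x)) (ι x') (ι y') (φ (ι y))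
  rw [dist_comm (ι x') (φ (ι x))] at h1
  rw [dist_comm (ι y') (φ (ι y))] at h2
  constructor <;> linarith

/-- Isometries of `X` preserve labels. -/
theorem lab_eq_of_dist_lt_one [Nonempty 𝒟.K] (hι : Isometry ι) (hd : DenseRange ι) (φ : X ≃ᵢ X)
    {y y' : 𝒟.Space} (h : dist (φ (ι y)) (ι y') < 1) : lab y'.idx = lab y.idx := by
  -- Points of `ι` near the image of `φ` define a relation on labels. The total error `1 + 1 < 4`
  -- keeps colors, which makes it the graph of a color-preserving permutation, trivial by rigidity.
  let Rel : (X ≃ᵢ X) → Option (ℕ × 𝒟.K) → Option (ℕ × 𝒟.K) → Prop := fun φ r s =>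
    ∃ y y' : 𝒟.Space, lab y.idx = r ∧ lab y'.idx = s ∧ dist (φ (ι y)) (ι y') < 1
  have hc : ∀ {φ r s r' s'}, Rel φ r s → Rel φ r' s' → 𝒟.c s s' = 𝒟.c r r' := by
    rintro φ _ _ _ _ ⟨y, y', rfl, rfl, hy⟩ ⟨z, z', rfl, rfl, hz⟩
    exact c_eq_c_of_dist_lt ((abs_dist_sub_dist_le hι φ hy.le hz.le).trans_lt (by norm_num))
  have huniq : ∀ {φ r s s'}, Rel φ r s → Rel φ r s' → s = s' := fun h h' =>
    eq_of_c_eq_zero (by rw [hc h h', 𝒟.c_self])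
  have hsymm : ∀ {φ r s}, Rel φ r s → Rel φ.symm s r := by
    rintro φ _ _ ⟨y, y', rfl, rfl, hy⟩
    refine ⟨y', y, rfl, rfl, ?_⟩
    rwa [← φ.dist_eq, φ.apply_symm_apply, dist_comm]
  have htot : ∀ φ r, ∃ s, Rel φ r s := by
    intro φ r
    obtain ⟨a, ha⟩ : ∃ a : 𝒟.Idx, lab a = r := by
      rcases r with _ | p
      exacts [⟨.inr fun _ => Classical.arbitrary _, rfl⟩, ⟨.inl p, rfl⟩]
    obtain ⟨y', hy'⟩ := hd.exists_dist_lt (φ (ι ⟨a, 1⟩)) one_pos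
    exact ⟨_, ⟨a, 1⟩, y', ha, rfl, hy'⟩
  choose σ hσ using htot φ
  choose τ hτ using htot φ.symm
  let e : Equiv.Perm (Option (ℕ × 𝒟.K)) :=
    ⟨σ, τ, fun r => huniq (hτ _) (hsymm (hσ _)), fun r => huniq (hσ _) (hsymm (hτ _))⟩
  have h1 := 𝒟.c_rigid e (fun r s => hc (hσ r) (hσ s)) (lab y.idx)
  exact (huniq ⟨y, y', rfl, rfl, h⟩ (hσ _)).trans h1

section Approximation

variable [Nonempty 𝒟.K] (hι : Isometry ι) (hd : DenseRange ι) (φ : X ≃ᵢ X)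

include hι hd

theorem exists_near_inl (p : ℕ × 𝒟.K) (h : G) {ε : ℝ} (hε1 : ε < 1)
    (hε : ∀ x, ∃ y, dist x (ι y) ≤ ε) :
    ∃ g, dist (φ (ι ⟨.inl p, h⟩)) (ι ⟨.inl p, g⟩) ≤ ε := by
  obtain ⟨⟨a, g⟩, hy⟩ := hε (φ (ι ⟨.inl p, h⟩))
  have := lab_eq_of_dist_lt_one hι hd φ (hy.trans_lt hε1)
  rcases a with q | S
  · obtain rfl : q = p := Option.some.inj this
    exact ⟨g, hy⟩
  · cases this

theorem exists_near_inr (S : ℕ → 𝒟.K) (h : G) {ε : ℝ} (hε1 : ε < 1)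
    (hε : ∀ x, ∃ y, dist x (ι y) ≤ ε) :
    ∃ S' g, dist (φ (ι ⟨.inr S, h⟩)) (ι ⟨.inr S', g⟩) ≤ ε := by
  obtain ⟨⟨a, g⟩, hy⟩ := hε (φ (ι ⟨.inr S, h⟩))
  have := lab_eq_of_dist_lt_one hι hd φ (hy.trans_lt hε1)
  rcases a with q | S'
  · cases this
  · exact ⟨S', g, hy⟩

-- The source points agree in position `n`, contributing 0 to their distance; whatever the
-- approximate images contribute there must be approximation error.
omit [Nonempty 𝒟.K] hd in
theorem dW_le_of_dist_le {S S' : ℕ → 𝒟.K} {n : ℕ} {h g g' : G} {a b : ℝ}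
    (hS : dist (φ (ι ⟨.inr S, h⟩)) (ι ⟨.inr S', g⟩) ≤ a)
    (hn : dist (φ (ι ⟨.inl (n, S n), h⟩)) (ι ⟨.inl (n, S n), g'⟩) ≤ b) :
    (1 / 2 : ℝ) ^ n * dW (some (S' n)) g (some (S n)) g' ≤ a + b := by
  have := (abs_le.1 (abs_dist_sub_dist_le hι φ hS hn)).2
  rwa [dist_inr_inl_sub, dW_self, sub_zero] at this

/-- An isometry acts on any sequence of layers approximately as a single group element. -/
theorem exists_forall_dist_inl_le (S : ℕ → 𝒟.K) (h : G) {ε : ℝ} (hε1 : ε < 1)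
    (hε : ∀ x, ∃ y, dist x (ι y) ≤ ε) :
    ∃ g, ∀ n, 2 * ε < (1 / 2 : ℝ) ^ n →
      dist (φ (ι ⟨.inl (n, S n), h⟩)) (ι ⟨.inl (n, S n), g⟩) ≤ 3 * ε := by
  obtain ⟨S', g, hS⟩ := exists_near_inr hι hd φ S h hε1 hε
  refine ⟨g, fun n hn => ?_⟩
  obtain ⟨g', hg'⟩ := exists_near_inl hι hd φ (n, S n) h hε1 hε
  have h1 := dW_le_of_dist_le hι φ hS hg'
  -- Otherwise the `n`th term would be at least `2⁻ⁿ`, exceeding the error `2 * ε`.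
  have h2 : S' n = S n := eq_of_dW_lt_one (g := g) (h := g') (by
    have h3 : (0 : ℝ) < (1 / 2) ^ n := by positivity
    by_contra! h4
    have := mul_le_mul_of_nonneg_left h4 h3.le
    linarith)
  rw [h2, dW_some_self, ← dist_inl, ← hι.dist_eq, dist_comm] at h1
  linarith [dist_triangle (φ (ι ⟨.inl (n, S n), h⟩)) (ι ⟨.inl (n, S n), g'⟩)
    (ι ⟨.inl (n, S n), g⟩)]

/-- The constant sequence at `S n` compares layer `(n, S n)` with `(0, S n)`. Undoing the scale
`2⁻ⁿ` of the former accounts for the term `6 * 2 ^ n`. -/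
theorem exists_forall_dist_inl_zero_le (S : ℕ → 𝒟.K) {ε : ℝ} (hε1 : ε < 1)
    (hε : ∀ x, ∃ y, dist x (ι y) ≤ ε) :
    ∃ g, ∀ n, 2 * ε < (1 / 2 : ℝ) ^ n →
      dist (φ (ι ⟨.inl (0, S n), 1⟩)) (ι ⟨.inl (0, S n), g⟩) ≤ (3 + 6 * 2 ^ n) * ε := by
  obtain ⟨g, hg⟩ := exists_forall_dist_inl_le hι hd φ S 1 hε1 hε
  refine ⟨g, fun n hn => ?_⟩
  obtain ⟨g', hg'⟩ := exists_forall_dist_inl_le hι hd φ (fun _ => S n) 1 hε1 hε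
  have h0 := hg' 0 (hn.trans_le (pow_le_pow_of_le_one (by norm_num) (by norm_num) n.zero_le))
  have h1 := dist_triangle_left (ι ⟨.inl (n, S n), g'⟩) (ι ⟨.inl (n, S n), g⟩)
    (φ (ι ⟨.inl (n, S n), 1⟩))
  rw [hι.dist_eq, dist_inl] at h1
  have h2 : ρ (S n).1 (g' * (S n).2) (g * (S n).2) ≤ 6 * 2 ^ n * ε := by
    have h3 : (1 / 2 : ℝ) ^ n * ρ (S n).1 (g' * (S n).2) (g * (S n).2) ≤ 6 * ε := by
      linarith [hg n hn, hg' n hn]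
    rw [one_div, inv_pow, inv_mul_le_iff₀ (by positivity)] at h3
    linarith
  have h4 := dist_triangle (φ (ι ⟨.inl (0, S n), 1⟩)) (ι ⟨.inl (0, S n), g'⟩)
    (ι ⟨.inl (0, S n), g⟩)
  rw [hι.dist_eq ⟨_, g'⟩, dist_inl] at h4
  linarith

end Approximation

end GaugeData

/-! ### Convergence of group elements to an isometry. -/

namespace GaugeData

open Filter

variable {G : Type u} [Group G] {𝒟 : GaugeData G}

section Continuity

variable [TopologicalSpace G] [IsTopologicalGroup G]

theorem tendsto_ρ (hN : ∀ i, Tendsto (𝒟.N i) (𝓝 1) (𝓝 0)) (i : 𝒟.I) (a g₀ : G) :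
    Tendsto (fun g => ρ i (g * a) (g₀ * a)) (𝓝 g₀) (𝓝 0) := by
  have : Tendsto (fun g : G => (g * a)⁻¹ * (g₀ * a)) (𝓝 g₀) (𝓝 1) := by
    have h : Continuous fun g : G => (g * a)⁻¹ * (g₀ * a) := by fun_prop
    simpa using h.tendsto g₀
  exact (hN i).comp this

theorem continuous_mk (hN : ∀ i, Tendsto (𝒟.N i) (𝓝 1) (𝓝 0)) (a : 𝒟.Idx) :
    Continuous fun g => (⟨a, g⟩ : 𝒟.Space) := by
  refine continuous_iff_continuousAt.2 fun g₀ => tendsto_iff_dist_tendsto_zero.2 ?_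
  have h : ∀ g, dist (⟨a, g⟩ : 𝒟.Space) ⟨a, g₀⟩ =
      ∑' n, (1 / 2 : ℝ) ^ n * dW (seq a n) g (seq a n) g₀ := by
    intro g
    simp [dist_eq, 𝒟.c_self, dSeq]
  simp only [h]
  rw [show (0 : ℝ) = ∑' n : ℕ, (1 / 2 : ℝ) ^ n * 0 by simp]
  refine tendsto_tsum_of_dominated_convergence (bound := fun n => (1 / 2 : ℝ) ^ n * 2)
    (summable_geometric_two.mul_right 2) (fun n => Tendsto.const_mul _ ?_)
    (Eventually.of_forall fun g n => ?_)
  · rcases seq a n with _ | k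
    · simp [dW_none_none]
    · simpa only [dW_some_self] using tendsto_ρ hN k.1 k.2 g₀
  · rw [Real.norm_of_nonneg (mul_nonneg (by positivity) (dW_nonneg _ _ _ _))]
    exact mul_le_mul_of_nonneg_left (dW_le_two _ _ _ _) (by positivity)

end Continuity

variable {X : Type v} [MetricSpace X] [MulAction G X] {ι : 𝒟.Space → X}

theorem isClosed_setOf_tendsto_smul [IsIsometricSMul G X] (φ : X ≃ᵢ X) (F : Filter G) :
    IsClosed {x | Tendsto (fun g : G => g • x) F (𝓝 (φ x))} := by
  refine isClosed_of_closure_subset fun x hx => Metric.tendsto_nhds.2 fun ε hε => ?_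
  obtain ⟨y, hy, hxy⟩ := Metric.mem_closure_iff.1 hx (ε / 3) (by positivity)
  filter_upwards [Metric.tendsto_nhds.1 hy (ε / 3) (by positivity)] with g hg
  have h := dist_triangle4 (g • x) (g • y) (φ y) (φ x)
  rw [dist_smul, φ.dist_eq, dist_comm y x] at h
  linarith

section Convergence

variable [Nonempty 𝒟.K] (hι : Isometry ι) (hd : DenseRange ι)
  (hG : ∀ (g : G) y, ι (g • y) = g • ι y) (φ : X ≃ᵢ X)

include hι hd hG

/-- As `h * a = b`, the seminorm part of the distance between the two source points vanishes. Their
images must stay aligned, so an element close to `φ` at one point is as close at the other. -/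
theorem dist_smul_inl_zero_le {i : 𝒟.I} {a b : 𝒟.D} {h : G} (hab : h * a = b) (g : G) :
    dist (φ (ι ⟨.inl (0, i, a), h⟩)) (g • ι ⟨.inl (0, i, a), h⟩) ≤
      dist (φ (ι ⟨.inl (0, i, b), 1⟩)) (g • ι ⟨.inl (0, i, b), 1⟩) := by
  refine le_of_forall_pos_le_add fun ε hε => ?_
  obtain ⟨δ, hδ0, hδ⟩ := exists_between (lt_min (half_pos hε) one_pos)
  have hδ1 := hδ.trans_le (min_le_right _ _)
  have hδε := hδ.trans_le (min_le_left _ _)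
  obtain ⟨h', hh'⟩ := exists_near_inl hι hd φ (0, i, a) h hδ1
    fun x => (hd.exists_dist_lt x hδ0).imp fun _ => le_of_lt
  simp only [← hG, smul_mk, mul_one]
  have h1 := (abs_le.1 (abs_dist_sub_dist_le hι φ hh'
    (le_refl (dist (φ (ι ⟨.inl (0, i, b), 1⟩)) (ι ⟨.inl (0, i, b), g⟩))))).2
  rw [dist_inl_sub_dist_inl] at h1
  simp only [dW, ↓reduceIte, pow_zero, one_mul, add_sub_add_left_eq_sub, hab, ρ_self, sub_zero]
    at h1
  have h2 := dist_triangle (φ (ι ⟨.inl (0, i, a), h⟩)) (ι ⟨.inl (0, i, a), h'⟩)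
    (ι ⟨.inl (0, i, a), g * h⟩)
  rw [hι.dist_eq ⟨_, h'⟩, dist_inl] at h2
  simp only [mul_assoc, hab, pow_zero, one_mul] at h2
  linarith

/-- The constant sequence at `k` gives one element imitating `φ` on both layers, and layer `n` is
scaled by `2⁻ⁿ ≤ 1`. -/
theorem dist_smul_inl_le (k : 𝒟.K) (h : G) (n : ℕ) (g : G) :
    dist (φ (ι ⟨.inl (n, k), h⟩)) (g • ι ⟨.inl (n, k), h⟩) ≤
      dist (φ (ι ⟨.inl (0, k), h⟩)) (g • ι ⟨.inl (0, k), h⟩) := by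
  refine le_of_forall_pos_le_add fun ε hε => ?_
  obtain ⟨δ, hδ0, hδ⟩ := exists_between
    (lt_min (show 0 < ε / 6 by positivity) (show (0 : ℝ) < (1 / 2) ^ n / 2 by positivity))
  have hδn := hδ.trans_le (min_le_right _ _)
  have hδε := hδ.trans_le (min_le_left _ _)
  have hn1 : (1 / 2 : ℝ) ^ n ≤ 1 := pow_le_one₀ (by norm_num) (by norm_num)
  obtain ⟨g', hg'⟩ := exists_forall_dist_inl_le hι hd φ (fun _ => k) h (ε := δ) (by linarith)
    fun x => (hd.exists_dist_lt x hδ0).imp fun _ => le_of_lt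
  have hn := hg' n (by linarith)
  have h0 := hg' 0 (by rw [pow_zero]; linarith)
  simp only [← hG, smul_mk]
  have h1 := dist_triangle_left (ι ⟨.inl (0, k), g'⟩) (ι ⟨.inl (0, k), g * h⟩)
    (φ (ι ⟨.inl (0, k), h⟩))
  have h2 := dist_triangle (φ (ι ⟨.inl (n, k), h⟩)) (ι ⟨.inl (n, k), g'⟩)
    (ι ⟨.inl (n, k), g * h⟩)
  rw [hι.dist_eq ⟨_, g'⟩, dist_inl] at h1 h2
  have h3 := mul_le_mul_of_nonneg_right hn1 (ρ_nonneg k.1 (g' * k.2) (g * h * k.2))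
  rw [pow_zero] at h1
  linarith

theorem tendsto_smul_inr (S : ℕ → 𝒟.K) (h : G) (F : Filter G)
    (hF : ∀ n k, Tendsto (fun g : G => g • ι ⟨.inl (n, k), h⟩) F (𝓝 (φ (ι ⟨.inl (n, k), h⟩)))) :
    Tendsto (fun g : G => g • ι ⟨.inr S, h⟩) F (𝓝 (φ (ι ⟨.inr S, h⟩))) := by
  refine Metric.tendsto_nhds.2 fun ε hε => ?_
  obtain ⟨M, hM⟩ := exists_pow_lt_of_lt_one (show 0 < ε / 16 by positivity)
    (show (1 / 2 : ℝ) < 1 by norm_num)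
  -- The final error is `δ` plus `2 * δ` for each of the first `M` positions plus the tail `4 *
  -- 2⁻ᴹ`. The tail is below `ε / 4`, and `(2 * M + 1) * δ` is below `ε / 2`.
  obtain ⟨δ, hδ0, hδ⟩ := exists_between
    (lt_min (show 0 < ε / (4 * (M + 1)) by positivity) one_pos)
  have hδ1 := hδ.trans_le (min_le_right _ _)
  have hδM : δ * (4 * (M + 1)) < ε := by
    rw [← lt_div_iff₀ (by positivity)]
    exact hδ.trans_le (min_le_left _ _)
  obtain ⟨S', h', hS⟩ := exists_near_inr hι hd φ S h hδ1
    fun x => (hd.exists_dist_lt x hδ0).imp fun _ => le_of_lt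
  have hev : ∀ᶠ g : G in F, ∀ n ∈ Finset.range M,
      dist (g • ι ⟨.inl (n, S n), h⟩) (φ (ι ⟨.inl (n, S n), h⟩)) < δ :=
    (Finset.eventually_all _).2 fun n _ => Metric.tendsto_nhds.1 (hF n (S n)) δ hδ0
  filter_upwards [hev] with g hg
  have hsum := summable_dW (fun n => some (S' n)) (fun n => some (S n)) h' (g * h)
  have h1 : dist (⟨.inr S', h'⟩ : 𝒟.Space) ⟨.inr S, g * h⟩ ≤ M * (2 * δ) + 4 * (1 / 2) ^ M := by
    rw [dist_inr, ← hsum.sum_add_tsum_nat_add M]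
    refine add_le_add ?_ ?_
    · rw [← Finset.card_range M, ← nsmul_eq_mul, Finset.card_range]
      conv_rhs => rw [← Finset.card_range M]
      refine Finset.sum_le_card_nsmul _ _ _ fun n hn => ?_
      have hgn := hg n hn
      rw [dist_comm, ← hG, smul_mk] at hgn
      linarith [dW_le_of_dist_le hι φ hS hgn.le]
    · have h2 : ∑' n : ℕ, (1 / 2 : ℝ) ^ n * (2 * (1 / 2) ^ M) = 4 * (1 / 2) ^ M := by
        rw [tsum_mul_right, tsum_geometric_two]; ring
      rw [← h2]
      refine ((summable_nat_add_iff M).2 hsum).tsum_le_tsum (fun n => ?_)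
        (summable_geometric_two.mul_right _)
      have := mul_le_mul_of_nonneg_left (dW_le_two (some (S' (n + M))) h' (some (S (n + M))) (g * h))
        (show (0 : ℝ) ≤ (1 / 2) ^ (n + M) by positivity)
      refine this.trans (le_of_eq ?_)
      rw [pow_add]; ring
  have h3 := dist_triangle (φ (ι ⟨.inr S, h⟩)) (ι ⟨.inr S', h'⟩) (ι ⟨.inr S, g * h⟩)
  rw [hι.dist_eq ⟨_, h'⟩] at h3
  rw [dist_comm, ← hG, smul_mk]
  nlinarith

/-- Convergence of a filter on `G` to an isometry can be tested on the points `(inl (0, k), 1)`. -/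
theorem tendsto_smul_of_tendsto [TopologicalSpace G] [IsTopologicalGroup G] [IsIsometricSMul G X]
    (hN : ∀ i, Tendsto (𝒟.N i) (𝓝 1) (𝓝 0)) (hD : Dense 𝒟.D) {F : Filter G}
    (hF : ∀ k, Tendsto (fun g : G => g • ι ⟨.inl (0, k), 1⟩) F (𝓝 (φ (ι ⟨.inl (0, k), 1⟩))))
    (x : X) : Tendsto (fun g : G => g • x) F (𝓝 (φ x)) := by
  have hdist : ∀ {x y : X}, (∀ g : G, dist (φ x) (g • x) ≤ dist (φ y) (g • y)) →
      Tendsto (fun g : G => g • y) F (𝓝 (φ y)) → Tendsto (fun g : G => g • x) F (𝓝 (φ x)) := by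
    intro x y hxy hy
    rw [tendsto_iff_dist_tendsto_zero] at hy ⊢
    refine squeeze_zero (fun _ => dist_nonneg) (fun g => ?_) hy
    simpa only [dist_comm] using hxy g
  have hcl := isClosed_setOf_tendsto_smul (G := G) φ F
  have h0 : ∀ k h, Tendsto (fun g : G => g • ι ⟨.inl (0, k), h⟩) F
      (𝓝 (φ (ι ⟨.inl (0, k), h⟩))) := by
    rintro ⟨i, a⟩ h
    -- For these `h`, the point can be compared with the base point of the layer `(0, i, h * a)`.
    have hdense : Dense {h : G | h * a ∈ 𝒟.D} := hD.preimage (Homeomorph.mulRight (a : G)).isOpenMap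
    refine closure_minimal (s := {h : G | h * a ∈ 𝒟.D}) (fun h hh => ?_)
      (hcl.preimage (hι.continuous.comp (continuous_mk hN (.inl (0, i, a))))) (hdense h)
    exact hdist (dist_smul_inl_zero_le hι hd hG φ (b := ⟨h * a, hh⟩) rfl) (hF _)
  have h1 : ∀ n k h, Tendsto (fun g : G => g • ι ⟨.inl (n, k), h⟩) F
      (𝓝 (φ (ι ⟨.inl (n, k), h⟩))) := fun n k h =>
    hdist (dist_smul_inl_le hι hd hG φ k h n) (h0 k h)
  refine closure_minimal (s := Set.range ι) ?_ hcl (hd x)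
  rintro _ ⟨⟨p | S, h⟩, rfl⟩
  · exact h1 _ _ _
  · exact tendsto_smul_inr hι hd hG φ S h F fun n k => h1 n k h

end Convergence

end GaugeData

/-! ### Every isometry comes from a group element. -/

namespace GaugeData

open Filter

variable {G : Type u} [Group G] {𝒟 : GaugeData G} {X : Type v} [MetricSpace X] [MulAction G X]
  {ι : 𝒟.Space → X}

/-- The point `a⁻¹` cancels the right translation by `a`, so its displacement is the seminorm
itself; this recovers the topology and the Cauchy condition of `G` from the action. -/
theorem dist_smul_mk_inv (hι : Isometry ι) (hG : ∀ (g : G) y, ι (g • y) = g • ι y) (i : 𝒟.I)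
    (a : 𝒟.D) (g h : G) :
    dist (g • ι ⟨.inl (0, i, a), (a : G)⁻¹⟩) (h • ι ⟨.inl (0, i, a), (a : G)⁻¹⟩) =
      𝒟.N i (g⁻¹ * h) := by
  rw [← hG, ← hG, hι.dist_eq, smul_mk, smul_mk, dist_inl]
  simp [ρ]

theorem tendsto_inv_smul [IsIsometricSMul G X] {φ : X ≃ᵢ X} {F : Filter G}
    (hF : ∀ x, Tendsto (fun g : G => g • x) F (𝓝 (φ x))) (x : X) :
    Tendsto (fun g : G => g⁻¹ • x) F (𝓝 (φ.symm x)) := by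
  have := tendsto_iff_dist_tendsto_zero.1 (hF (φ.symm x))
  refine tendsto_iff_dist_tendsto_zero.2 (this.congr fun g => ?_)
  rw [φ.apply_symm_apply, ← dist_smul g (g⁻¹ • x), smul_inv_smul, dist_comm]

variable [TopologicalSpace G] [IsTopologicalGroup G]
  [Nonempty 𝒟.K] (hι : Isometry ι) (hd : DenseRange ι)
  (hG : ∀ (g : G) y, ι (g • y) = g • ι y)
  (hN : ∀ i, Tendsto (𝒟.N i) (𝓝 1) (𝓝 0)) (hD : Dense 𝒟.D)
  (hU : ∀ U ∈ 𝓝 (1 : G), ∃ i, ∀ g, 𝒟.N i g < 1 → g ∈ U)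

include hι hG hU in
theorem tendsto_of_tendsto_smul {α : Type*} {F : Filter α} {u : α → G} {g : G}
    (h : ∀ x : X, Tendsto (fun i => u i • x) F (𝓝 (g • x))) : Tendsto u F (𝓝 g) := by
  refine tendsto_def.2 fun W hW => ?_
  obtain ⟨-, a⟩ := Classical.arbitrary 𝒟.K
  -- The map `v ↦ g * v⁻¹` sends `(u j)⁻¹ * g` to `u j`.
  have hc : Continuous fun v : G => g * v⁻¹ := by fun_prop
  obtain ⟨i, hi⟩ := hU ((fun v : G => g * v⁻¹) ⁻¹' W)
    (hc.continuousAt.preimage_mem_nhds (by simpa using hW))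
  filter_upwards [Metric.tendsto_nhds.1 (h (ι ⟨.inl (0, i, a), (a : G)⁻¹⟩)) 1 one_pos] with j hj
  change u j ∈ W
  rw [dist_smul_mk_inv hι hG] at hj
  simpa using hi _ hj

variable [IsIsometricSMul G X]

include hι hd hG hN hD in
theorem continuous_smul_left (x : X) : Continuous fun g : G => g • x := by
  refine continuous_iff_continuousAt.2 fun g => ?_
  refine tendsto_smul_of_tendsto hι hd hG (IsometryEquiv.constSMul g) hN hD (fun k => ?_) x
  simp only [IsometryEquiv.constSMul_apply, ← hG, smul_mk, mul_one]
  exact (hι.continuous.comp (continuous_mk hN _)).tendsto g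

include hι hd hG hN hD hU in
/-- If every isometry of `X` is given by the action of an element of `G`, then `G` is the isometry
group of `X`. -/
theorem nonempty_continuousMulEquiv [T2Space G]
    (hsurj : ∀ φ : X ≃ᵢ X, ∃ g : G, ∀ x, g • x = φ x) : Nonempty (G ≃ₜ* (X ≃ᵢ X)) := by
  let e : G →* (X ≃ᵢ X) :=
    { toFun := IsometryEquiv.constSMul
      map_one' := by ext x; simp
      map_mul' := fun g h => by ext x; simp [mul_smul] }
  have he : ∀ g x, e g x = g • x := fun g x => rfl
  have hinj : Function.Injective e := by
    intro g h hgh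
    refine tendsto_nhds_unique (f := fun _ : Unit => g) (l := pure ()) (tendsto_const_nhds) ?_
    refine tendsto_of_tendsto_smul hι hG hU fun x => ?_
    rw [← he, ← he, hgh]
    exact tendsto_const_nhds
  have hbij : Function.Bijective e := ⟨hinj, fun φ => by
    obtain ⟨g, hg⟩ := hsurj φ
    exact ⟨g, IsometryEquiv.ext hg⟩⟩
  let E := MulEquiv.ofBijective e hbij
  have hE : ∀ g x, E g x = g • x := fun g x => rfl
  refine ⟨{ E with continuous_toFun := ?_, continuous_invFun := ?_ }⟩
  · exact continuous_induced_rng.2 (continuous_pi fun x => continuous_smul_left hι hd hG hN hD x)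
  · refine continuous_iff_continuousAt.2 fun φ => tendsto_of_tendsto_smul hι hG hU fun x => ?_
    change Tendsto (fun ψ : X ≃ᵢ X => E.symm ψ • x) _ (𝓝 (E.symm φ • x))
    simp only [← hE, E.apply_symm_apply]
    exact (continuous_apply_isometryEquiv x).tendsto φ

-- A neighbourhood in the product constrains finitely many base points, and a sequence enumerating
-- their keys yields one element imitating `φ` at all of them. Displacements of `φ` and of its
-- inverse make the filter Cauchy on both sides.
include hι hd hG hN hD hU in
theorem exists_smul_eq_of_isRaikovComplete (hc : IsRaikovComplete G) (φ : X ≃ᵢ X) :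
    ∃ g : G, ∀ x, g • x = φ x := by
  let e : 𝒟.K → X := fun k => ι ⟨.inl (0, k), 1⟩
  let F : Filter G := comap (fun (g : G) k => g • e k) (𝓝 fun k => φ (e k))
  have hF : F.NeBot := by
    refine comap_neBot_iff.2 fun t ht => ?_
    rw [nhds_pi, Filter.mem_pi] at ht
    obtain ⟨I, hI, W, hW, hWt⟩ := ht
    -- The extra key only keeps the set nonempty, as an enumeration requires.
    obtain ⟨S, hS⟩ := (hI.insert (Classical.arbitrary 𝒟.K)).countable.exists_eq_range
      (Set.insert_nonempty _ _)
    have hk : ∀ k ∈ I, ∃ n, S n = k := fun k hk => by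
      have : k ∈ Set.range S := hS ▸ Set.mem_insert_of_mem _ hk
      exact this
    choose! n hn using hk
    choose r hr0 hr using fun k => Metric.mem_nhds_iff.1 (hW k)
    have hev : ∀ᶠ ε : ℝ in 𝓝[>] 0, (0 < ε ∧ ε < 1) ∧
        ∀ k ∈ I, 2 * ε < (1 / 2) ^ n k ∧ (3 + 6 * 2 ^ n k) * ε < r k := by
      have hlt : ∀ a b : ℝ, 0 < b → ∀ᶠ ε : ℝ in 𝓝[>] 0, a * ε < b := fun a b hb => by
        have hca : Continuous fun ε : ℝ => a * ε := by fun_prop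
        exact (hca.tendsto 0).mono_left nhdsWithin_le_nhds |>.eventually_lt_const (by simpa using hb)
      have hpos : ∀ᶠ ε : ℝ in 𝓝[>] 0, 0 < ε := self_mem_nhdsWithin
      refine (hpos.and ((hlt 1 1 one_pos).mono fun ε h => by simpa using h)).and ?_
      exact (eventually_all_finite hI).2 fun k _ =>
        (hlt _ _ (by positivity)).and (hlt _ _ (hr0 k))
    obtain ⟨ε, ⟨hε0, hε1⟩, hε⟩ := hev.exists
    obtain ⟨g, hg⟩ := exists_forall_dist_inl_zero_le hι hd φ S hε1
      fun x => (hd.exists_dist_lt x hε0).imp fun _ => le_of_lt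
    refine ⟨g, hWt fun k hk => hr k ?_⟩
    have h1 := hg (n k) (by simpa [hn k hk] using (hε k hk).1)
    rw [hn k hk] at h1
    rw [Metric.mem_ball, dist_comm]
    simp only [e, ← hG, smul_mk, mul_one]
    exact h1.trans_lt (hε k hk).2
  have hlim : ∀ x, Tendsto (fun g : G => g • x) F (𝓝 (φ x)) :=
    tendsto_smul_of_tendsto hι hd hG φ hN hD fun k =>
      (tendsto_pi_nhds.1 (tendsto_comap (f := fun (g : G) k => g • e k))) k
  obtain ⟨g, hg⟩ := (isRaikovComplete_iff G).1 hc F hF fun U hUn => by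
    obtain ⟨i, hi⟩ := hU U hUn
    obtain ⟨-, a⟩ := Classical.arbitrary 𝒟.K
    refine ⟨_, inter_mem
      (Metric.tendsto_nhds.1 (hlim (ι ⟨.inl (0, i, a), (a : G)⁻¹⟩)) (1 / 2) (by norm_num))
      (Metric.tendsto_nhds.1 (tendsto_inv_smul hlim (ι ⟨.inl (0, i, a), (a : G)⁻¹⟩)) (1 / 2)
        (by norm_num)), fun b hb c hc => ⟨hi _ ?_, hi _ ?_⟩⟩
    · rw [← dist_smul_mk_inv hι hG i a]
      refine (dist_triangle_right _ _ _).trans_lt ((add_lt_add hb.1 hc.1).trans_eq (by norm_num))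
    · rw [show c * b⁻¹ = c⁻¹⁻¹ * b⁻¹ by simp, ← dist_smul_mk_inv hι hG i a]
      refine (dist_triangle_right _ _ _).trans_lt ((add_lt_add hc.2 hb.2).trans_eq (by norm_num))
  exact ⟨g, fun x => tendsto_nhds_unique
    (((continuous_smul_left hι hd hG hN hD x).tendsto g).mono_left hg) (hlim x)⟩

-- Surjectivity of `ι` allows the approximation lemmas at `ε = 0`, where the condition on `n` always
-- holds: one element agrees with `φ` at countably many base points. The filter may therefore be
-- closed under countable intersections.
include hι hG hN hD hU in
theorem exists_smul_eq_of_isGdeltaComplete (hs : Function.Surjective ι) (hc : IsGdeltaComplete G)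
    (φ : X ≃ᵢ X) : ∃ g : G, ∀ x, g • x = φ x := by
  let e : 𝒟.K → X := fun k => ι ⟨.inl (0, k), 1⟩
  let F : Filter G := countableGenerate (Set.range fun k => {g : G | g • e k = φ (e k)})
  have hF : F.NeBot := by
    refine ⟨fun hbot => ?_⟩
    obtain ⟨T, hTr, hTc, hT⟩ := mem_countableGenerate_iff.1 (hbot.symm ▸ mem_bot : (∅ : Set G) ∈ F)
    obtain ⟨V, hV⟩ := (hTc.insert {g : G | g • e (Classical.arbitrary 𝒟.K) =
      φ (e (Classical.arbitrary 𝒟.K))}).exists_eq_range (Set.insert_nonempty _ _)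
    have hk : ∀ n, ∃ k, {g : G | g • e k = φ (e k)} = V n := fun n => by
      have : V n ∈ Set.range V := ⟨n, rfl⟩
      rw [← hV] at this
      rcases this with h | h
      exacts [⟨_, h.symm⟩, hTr h]
    choose S hS using hk
    obtain ⟨g, hg⟩ := exists_forall_dist_inl_zero_le hι hs.denseRange φ S zero_lt_one
      fun x => (hs x).imp fun y hy => by simp [hy]
    refine hT (a := g) fun W hW => ?_
    obtain ⟨n, rfl⟩ : W ∈ Set.range V := hV ▸ Set.mem_insert_of_mem _ hW
    rw [← hS]
    have h1 := hg n (by simp)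
    rw [mul_zero, dist_le_zero] at h1
    simp only [e, Set.mem_ofPred_eq, ← hG, smul_mk, mul_one]
    exact h1.symm
  have hlim : ∀ x, Tendsto (fun g : G => g • x) F (𝓝 (φ x)) :=
    tendsto_smul_of_tendsto hι hs.denseRange hG φ hN hD fun k =>
      tendsto_nhds_of_eventually_eq (CountableGenerateSets.basic ⟨k, rfl⟩)
  -- Under countable intersections, being within `1 / (n + 1)` for all `n` holds eventually, so
  -- convergence becomes eventual equality.
  have hev : ∀ (u : G → X) (y : X), Tendsto u F (𝓝 y) → ∀ᶠ g in F, u g = y := by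
    intro u y h
    have h1 : ∀ᶠ g in F, ∀ n : ℕ, dist (u g) y < 1 / (n + 1) :=
      eventually_countable_forall.2 fun n => Metric.tendsto_nhds.1 h _ Nat.one_div_pos_of_nat
    filter_upwards [h1] with g hg
    refine dist_le_zero.1 (ge_of_tendsto' tendsto_one_div_add_atTop_nhds_zero_nat fun n => (hg n).le)
  obtain ⟨g, hg⟩ := (isGdeltaComplete_iff G).1 hc F hF fun U hUδ hU1 => by
    obtain ⟨V, hVo, rfl⟩ := isGδ_iff_eq_iInter_nat.1 hUδ
    choose i hi using fun n => hU (V n) ((hVo n).mem_nhds (Set.mem_iInter.1 hU1 n))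
    obtain ⟨-, a⟩ := Classical.arbitrary 𝒟.K
    let x : ℕ → X := fun n => ι ⟨.inl (0, i n, a), (a : G)⁻¹⟩
    have hA : ∀ᶠ g : G in F, ∀ n, g • x n = φ (x n) ∧ g⁻¹ • x n = φ.symm (x n) :=
      eventually_countable_forall.2 fun n =>
        (hev _ _ (hlim (x n))).and (hev _ _ (tendsto_inv_smul hlim (x n)))
    refine ⟨_, hA, fun b hb c hc => ⟨Set.mem_iInter.2 fun n => hi n _ ?_,
      Set.mem_iInter.2 fun n => hi n _ ?_⟩⟩
    · rw [← dist_smul_mk_inv hι hG (i n) a]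
      change dist (b • x n) (c • x n) < 1
      rw [(hb n).1, (hc n).1, dist_self]
      exact one_pos
    · rw [show c * b⁻¹ = c⁻¹⁻¹ * b⁻¹ by simp, ← dist_smul_mk_inv hι hG (i n) a]
      change dist (c⁻¹ • x n) (b⁻¹ • x n) < 1
      rw [(hb n).2, (hc n).2, dist_self]
      exact one_pos
  have hle : F ≤ 𝓝 g := fun W hW => by
    obtain ⟨O, hOW, hO, hgO⟩ := mem_nhds_iff.1 hW
    exact mem_of_superset (hg O hO.isGδ hgO) hOW
  exact ⟨g, fun x => tendsto_nhds_unique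
    (((continuous_smul_left hι hs.denseRange hG hN hD x).tendsto g).mono_left hle) (hlim x)⟩

end GaugeData

/-! ### Weight, density and isometry groups. -/

section Weight

variable {X Y : Type u} [TopologicalSpace X] [TopologicalSpace Y]

theorem aleph0_le_topWeight (X : Type u) [TopologicalSpace X] : ℵ₀ ≤ topWeight X := le_max_left _ _

theorem topWeight_le {B : Set (Set X)} (hB : TopologicalSpace.IsTopologicalBasis B)
    {κ : Cardinal.{u}} (hκ : ℵ₀ ≤ κ) (h : #B ≤ κ) : topWeight X ≤ κ :=
  max_le hκ ((csInf_le' (Set.mem_ofPred_eq ▸ ⟨B, hB, rfl⟩)).trans h)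

theorem exists_basis_mk_le_topWeight (X : Type u) [TopologicalSpace X] :
    ∃ B : Set (Set X), TopologicalSpace.IsTopologicalBasis B ∧ #B ≤ topWeight X := by
  obtain ⟨B, hB, h⟩ := csInf_mem (s := {κ : Cardinal.{u} |
    ∃ B : Set (Set X), TopologicalSpace.IsTopologicalBasis B ∧ #B = κ})
    ⟨_, _, TopologicalSpace.isTopologicalBasis_opens, rfl⟩
  exact ⟨B, hB, h.trans_le (le_max_right _ _)⟩

theorem Topology.IsInducing.topWeight_le {f : X → Y} (hf : IsInducing f) :
    topWeight X ≤ topWeight Y := by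
  obtain ⟨B, hB, h⟩ := exists_basis_mk_le_topWeight Y
  exact _root_.topWeight_le (hB.isInducing hf) (aleph0_le_topWeight Y) (mk_image_le.trans h)

theorem exists_dense_mk_le_topWeight (X : Type u) [TopologicalSpace X] :
    ∃ D : Set X, Dense D ∧ #D ≤ topWeight X := by
  obtain ⟨B, hB, h⟩ := exists_basis_mk_le_topWeight X
  refine ⟨Set.range fun b : {b : B // b.1.Nonempty} => b.2.some, ?_,
    mk_range_le.trans ((mk_subtype_le _).trans h)⟩
  refine hB.dense_iff.2 fun b hb hne => ?_
  exact ⟨_, Set.Nonempty.some_mem hne, ⟨⟨b, hb⟩, hne⟩, rfl⟩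

theorem topWeight_le_of_dense {X : Type u} [PseudoMetricSpace X] {s : Set X} (hs : Dense s)
    {κ : Cardinal.{u}} (hκ : ℵ₀ ≤ κ) (h : #s ≤ κ) : topWeight X ≤ κ := by
  refine topWeight_le (B := Set.range fun p : s × ULift.{u} ℕ =>
    Metric.ball (p.1 : X) (1 / (p.2.down + 1))) ?_ hκ ?_
  · refine TopologicalSpace.isTopologicalBasis_of_isOpen_of_nhds ?_ fun x U hx hU => ?_
    · rintro _ ⟨p, rfl⟩
      exact Metric.isOpen_ball
    · obtain ⟨ε, hε, hεU⟩ := Metric.isOpen_iff.1 hU x hx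
      obtain ⟨n, hn⟩ := exists_nat_one_div_lt (half_pos hε)
      obtain ⟨y, hy, hxy⟩ := hs.exists_dist_lt x (Nat.one_div_pos_of_nat (n := n))
      refine ⟨_, ⟨⟨⟨y, hy⟩, ⟨n⟩⟩, rfl⟩, hxy, fun z hz => hεU ?_⟩
      have h1 : dist z y < 1 / (n + 1) := hz
      have h2 := dist_triangle_right z x y
      rw [Metric.mem_ball]
      linarith
  · refine mk_range_le.trans ?_
    rw [mk_prod, lift_id, lift_id]
    exact mul_le_of_le hκ h (by simpa using hκ)

/-- Isometries are equicontinuous, so pointwise convergence need only be tested on a dense set, with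
values in basic open sets. -/
theorem topWeight_isometryEquiv_le (X : Type u) [MetricSpace X] :
    topWeight (X ≃ᵢ X) ≤ topWeight X := by
  obtain ⟨B, hB, hBc⟩ := exists_basis_mk_le_topWeight X
  obtain ⟨D, hD, hDc⟩ := exists_dense_mk_le_topWeight X
  let s : D × B → Set (X ≃ᵢ X) := fun p => {f | f p.1 ∈ p.2.1}
  have hgen : isometryGroupTopology X = TopologicalSpace.generateFrom (Set.range s) := by
    refine le_antisymm (le_generateFrom ?_) ?_
    · rintro _ ⟨p, rfl⟩
      exact (hB.isOpen p.2.2).preimage (continuous_apply_isometryEquiv (p.1 : X))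
    · refine continuous_iff_le_induced.1 ?_
      let _ := TopologicalSpace.generateFrom (Set.range s)
      refine continuous_pi fun x => continuous_iff_continuousAt.2 fun f => ?_
      refine Metric.tendsto_nhds.2 fun ε hε => ?_
      obtain ⟨d, hd, hxd⟩ := hD.exists_dist_lt x (show 0 < ε / 3 by positivity)
      obtain ⟨b, hb, hfb, hbε⟩ := hB.exists_subset_of_mem_open
        (Metric.mem_ball_self (x := f d) (show 0 < ε / 3 by positivity)) Metric.isOpen_ball
      have hopen : IsOpen (s ⟨⟨d, hd⟩, ⟨b, hb⟩⟩) := TopologicalSpace.isOpen_generateFrom_of_mem ⟨_, rfl⟩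
      filter_upwards [hopen.mem_nhds hfb] with g hg
      have h1 : dist (g d) (f d) < ε / 3 := hbε hg
      have h2 := dist_triangle4 (g x) (g d) (f d) (f x)
      rw [g.dist_eq, f.dist_eq, dist_comm d x] at h2
      linarith
  refine topWeight_le (TopologicalSpace.isTopologicalBasis_of_subbasis hgen)
    (aleph0_le_topWeight X) ?_
  have hsub : (fun f => ⋂₀ f) '' {f : Set (Set (X ≃ᵢ X)) | f.Finite ∧ f ⊆ Set.range s} ⊆
      Set.range fun l : List (D × B) => ⋂ p ∈ l, s p := by
    rintro _ ⟨f, ⟨hf, hfs⟩, rfl⟩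
    choose q hq using fun a : f => hfs a.2
    have := hf.fintype
    refine ⟨(Finset.univ : Finset f).toList.map q, ?_⟩
    ext φ
    simp only [List.mem_map, Finset.mem_toList, Finset.mem_univ, true_and, Set.mem_iInter,
      Set.mem_sInter]
    refine ⟨fun h a ha => (hq ⟨a, ha⟩).subset (h _ ⟨⟨a, ha⟩, rfl⟩), ?_⟩
    rintro h _ ⟨a, rfl⟩
    exact (hq a).superset (h a a.2)
  refine (mk_le_mk_of_subset hsub).trans (mk_range_le.trans ((mk_list_le_max _).trans
    (max_le (aleph0_le_topWeight X) ?_)))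
  rw [mk_prod, lift_id, lift_id]
  exact mul_le_of_le (aleph0_le_topWeight X) hDc hBc

end Weight

/-! ### A small dense subset of the layered space. -/

namespace GaugeData

open Filter

variable {G : Type u} [Group G] {𝒟 : GaugeData G}

theorem dist_inr_le {S S' : ℕ → 𝒟.K} {M : ℕ} (h : ∀ n < M, S n = S' n) (g : G) :
    dist (⟨.inr S, g⟩ : 𝒟.Space) ⟨.inr S', g⟩ ≤ 4 * (1 / 2) ^ M := by
  have hsum := summable_dW (fun n => some (S n)) (fun n => some (S' n)) g g
  rw [dist_inr, ← hsum.sum_add_tsum_nat_add M, Finset.sum_eq_zero, zero_add]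
  · have h2 : ∑' n : ℕ, (1 / 2 : ℝ) ^ n * (2 * (1 / 2) ^ M) = 4 * (1 / 2) ^ M := by
      rw [tsum_mul_right, tsum_geometric_two]; ring
    rw [← h2]
    refine ((summable_nat_add_iff M).2 hsum).tsum_le_tsum (fun n => ?_)
      (summable_geometric_two.mul_right _)
    have := mul_le_mul_of_nonneg_left (dW_le_two (some (S (n + M))) g (some (S' (n + M))) g)
      (show (0 : ℝ) ≤ (1 / 2) ^ (n + M) by positivity)
    refine this.trans (le_of_eq ?_)
    rw [pow_add]; ring
  · intro n hn
    rw [h n (Finset.mem_range.1 hn), dW_self, mul_zero]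

theorem exists_dense_space_mk_le [TopologicalSpace G] [IsTopologicalGroup G]
    (hN : ∀ i, Tendsto (𝒟.N i) (𝓝 1) (𝓝 0)) (hD : Dense 𝒟.D) {κ : Cardinal.{u}} (hκ : ℵ₀ ≤ κ)
    (hIc : #𝒟.I ≤ κ) (hDc : #𝒟.D ≤ κ) : ∃ s : Set 𝒟.Space, Dense s ∧ #s ≤ κ := by
  -- All sequences may be too many. Finite lists padded by a constant number at most `κ` and match
  -- any sequence on an initial segment.
  let f : (ℕ × 𝒟.K) ⊕ (List 𝒟.K × 𝒟.K) → 𝒟.Idx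
    | .inl p => .inl p
    | .inr p => .inr fun n => p.1.getD n p.2
  let s : Set 𝒟.Space := Set.range fun p : ((ℕ × 𝒟.K) ⊕ (List 𝒟.K × 𝒟.K)) × 𝒟.D => ⟨f p.1, p.2⟩
  have hf : ∀ a g, (⟨f a, g⟩ : 𝒟.Space) ∈ closure s := fun a g =>
    closure_minimal (s := 𝒟.D) (t := (fun g => (⟨f a, g⟩ : 𝒟.Space)) ⁻¹' closure s)
      (fun d hd => subset_closure (Set.mem_range.2 ⟨(a, ⟨d, hd⟩), rfl⟩))
      (isClosed_closure.preimage (continuous_mk hN (f a))) (hD g)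
  refine ⟨s, ?_, ?_⟩
  · rintro ⟨p | S, g⟩
    · exact hf (.inl p) g
    · rw [← closure_closure]
      refine Metric.mem_closure_iff.2 fun ε hε => ?_
      obtain ⟨M, hM⟩ := exists_pow_lt_of_lt_one (show 0 < ε / 4 by positivity)
        (show (1 / 2 : ℝ) < 1 by norm_num)
      refine ⟨_, hf (.inr (List.ofFn fun n : Fin M => S n, S 0)) g, ?_⟩
      refine (dist_inr_le (M := M) (fun n hn => ?_) g).trans_lt (by linarith)
      simp [hn]
  · have hK : #𝒟.K ≤ κ := by
      rw [mk_prod, lift_id, lift_id]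
      exact mul_le_of_le hκ hIc hDc
    refine mk_range_le.trans ?_
    simp only [mk_prod, mk_sum, lift_id, lift_uzero, mk_nat, lift_aleph0]
    rw [mk_prod, lift_id, lift_id] at hK
    have hL := (mk_list_le_max 𝒟.K).trans (max_le hκ (by rwa [mk_prod, lift_id, lift_id]))
    exact mul_le_of_le hκ (add_le_of_le hκ (mul_le_of_le hκ hκ hK) (mul_le_of_le hκ hL hK)) hDc

end GaugeData

/-! ### Assembly of both equivalences. -/

section Main

open Filter

theorem exists_gaugeData (G : Type u) [Group G] [TopologicalSpace G] [IsTopologicalGroup G] :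
    ∃ 𝒟 : GaugeData G, Nonempty 𝒟.K ∧ (∀ i, Tendsto (𝒟.N i) (𝓝 1) (𝓝 0)) ∧ Dense 𝒟.D ∧
      (∀ U ∈ 𝓝 (1 : G), ∃ i, ∀ g, 𝒟.N i g < 1 → g ∈ U) ∧ #𝒟.I ≤ topWeight G ∧
      #𝒟.D ≤ topWeight G := by
  obtain ⟨B, hB, hBc⟩ := exists_basis_mk_le_topWeight G
  obtain ⟨D, hD, hDc⟩ := exists_dense_mk_le_topWeight G
  let I : Type u := {b : B // (1 : G) ∈ b.1}
  have hne : Nonempty (I × D) := by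
    obtain ⟨b, hb, h1, -⟩ := hB.exists_subset_of_mem_open (Set.mem_univ (1 : G)) isOpen_univ
    obtain ⟨d, hd⟩ := hD.nonempty
    exact ⟨⟨⟨b, hb⟩, h1⟩, ⟨d, hd⟩⟩
  choose N hN1 hN0 hNU using fun i : I =>
    exists_groupSeminorm_lt_one_subset ((hB.isOpen i.1.2).mem_nhds i.2)
  obtain ⟨c, h1, h2, h3, h4, h5⟩ := exists_rigid_coloring (Option (ℕ × I × D))
  refine ⟨⟨I, D, N, hN1, c, h1, h2, h3, h4, h5⟩, hne, hN0, hD, fun U hU => ?_,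
    (mk_subtype_le _).trans hBc, hDc⟩
  obtain ⟨b, hb, h1b, hbU⟩ := hB.mem_nhds_iff.1 hU
  exact ⟨⟨⟨b, hb⟩, h1b⟩, fun g hg => hbU (hNU _ g hg)⟩

/-- The dense set bounds the weight of `X` above; conversely `G` is a copy of an isometry group,
whose weight is at most that of `X`. -/
theorem ContinuousMulEquiv.topWeight_eq {G X : Type u} [Group G] [TopologicalSpace G]
    [MetricSpace X] (φ : G ≃ₜ* (X ≃ᵢ X)) {s : Set X} (hs : Dense s) (h : #s ≤ topWeight G) :
    topWeight X = topWeight G :=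
  le_antisymm (topWeight_le_of_dense hs (aleph0_le_topWeight G) h)
    (φ.toHomeomorph.isInducing.topWeight_le.trans (topWeight_isometryEquiv_le X))

variable {G : Type u} [Group G] [TopologicalSpace G] [IsTopologicalGroup G] [T2Space G]

theorem exists_metricSpace_of_isGdeltaComplete (hc : IsGdeltaComplete G) :
    ∃ (X : Type u) (_ : MetricSpace X), Nonempty (G ≃ₜ* (X ≃ᵢ X)) ∧ topWeight X = topWeight G := by
  obtain ⟨𝒟, _, hN, hD, hU, hIc, hDc⟩ := exists_gaugeData G
  let ι : 𝒟.Space → SeparationQuotient 𝒟.Space := SeparationQuotient.mk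
  have hι : Isometry ι := Isometry.of_dist_eq SeparationQuotient.dist_mk
  have hs : Function.Surjective ι := SeparationQuotient.surjective_mk
  have hG : ∀ (g : G) y, ι (g • y) = g • ι y := fun g y => rfl
  have hiso : IsIsometricSMul G (SeparationQuotient 𝒟.Space) :=
    ⟨fun g => Isometry.of_dist_eq fun x y => by
      obtain ⟨x, rfl⟩ := hs x
      obtain ⟨y, rfl⟩ := hs y
      rw [← hG, ← hG, hι.dist_eq, hι.dist_eq, dist_smul]⟩
  obtain ⟨φ⟩ := GaugeData.nonempty_continuousMulEquiv hι hs.denseRange hG hN hD hU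
    (GaugeData.exists_smul_eq_of_isGdeltaComplete hι hG hN hD hU hs hc)
  obtain ⟨s, hsd, hsc⟩ := GaugeData.exists_dense_space_mk_le hN hD (aleph0_le_topWeight G) hIc hDc
  exact ⟨_, inferInstance, ⟨φ⟩, φ.topWeight_eq (hs.denseRange.dense_image hι.continuous hsd)
    (mk_image_le.trans hsc)⟩

/-- In the completion `ι` has only dense range, so the imitation of `φ` is approximate and the
stronger completeness of `G` takes over. -/
theorem exists_completeSpace_of_isRaikovComplete (hc : IsRaikovComplete G) :
    ∃ (X : Type u) (_ : MetricSpace X), CompleteSpace X ∧ Nonempty (G ≃ₜ* (X ≃ᵢ X)) ∧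
      topWeight X = topWeight G := by
  obtain ⟨𝒟, _, hN, hD, hU, hIc, hDc⟩ := exists_gaugeData G
  let ι : 𝒟.Space → UniformSpace.Completion 𝒟.Space := (↑)
  have hι : Isometry ι := UniformSpace.Completion.coe_isometry
  have hd : DenseRange ι := UniformSpace.Completion.denseRange_coe
  have : UniformContinuousConstSMul G 𝒟.Space :=
    ⟨fun g => (isometry_smul 𝒟.Space g).uniformContinuous⟩
  have hG : ∀ (g : G) y, ι (g • y) = g • ι y := fun g y => UniformSpace.Completion.coe_smul g y
  have hiso : IsIsometricSMul G (UniformSpace.Completion 𝒟.Space) :=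
    ⟨fun g => (isometry_smul 𝒟.Space g).completion_map⟩
  obtain ⟨φ⟩ := GaugeData.nonempty_continuousMulEquiv hι hd hG hN hD hU
    (GaugeData.exists_smul_eq_of_isRaikovComplete hι hd hG hN hD hU hc)
  obtain ⟨s, hsd, hsc⟩ := GaugeData.exists_dense_space_mk_le hN hD (aleph0_le_topWeight G) hIc hDc
  exact ⟨_, inferInstance, inferInstance, ⟨φ⟩,
    φ.topWeight_eq (hd.dense_image hι.continuous hsd) (mk_image_le.trans hsc)⟩

/-- Isometric spaces have isomorphic isometry groups. -/
theorem IsometryEquiv.nonempty_continuousMulEquiv {X : Type*} {Y : Type*} [MetricSpace X]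
    [MetricSpace Y] (e : X ≃ᵢ Y) : Nonempty ((X ≃ᵢ X) ≃ₜ* (Y ≃ᵢ Y)) := by
  refine ⟨{ toFun := fun f => (e.symm.trans f).trans e
            invFun := fun f => (e.trans f).trans e.symm
            left_inv := fun f => by ext; simp
            right_inv := fun f => by ext; simp
            map_mul' := fun f g => by ext; simp
            continuous_toFun := ?_
            continuous_invFun := ?_ }⟩
  · exact continuous_induced_rng.2 (continuous_pi fun y =>
      e.continuous.comp (continuous_apply_isometryEquiv (e.symm y)))
  · exact continuous_induced_rng.2 (continuous_pi fun x =>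
      e.symm.continuous.comp (continuous_apply_isometryEquiv (e x)))

theorem theorem1p4 (G : Type u) [Group G] [TopologicalSpace G] [IsTopologicalGroup G]
    [T2Space G] :
    -- (A)
    (((∃ (X : Type (max u v)) (_ : MetricSpace X), Nonempty (G ≃ₜ* (X ≃ᵢ X))) ↔
        IsGdeltaComplete G) ∧
      (IsGdeltaComplete G →
        ∃ (X : Type u) (_ : MetricSpace X),
          Nonempty (G ≃ₜ* (X ≃ᵢ X)) ∧ topWeight X = topWeight G)) ∧
    -- (B)
    (((∃ (X : Type (max u v)) (_ : MetricSpace X),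
          CompleteSpace X ∧ Nonempty (G ≃ₜ* (X ≃ᵢ X))) ↔
        IsRaikovComplete G) ∧
      (IsRaikovComplete G →
        ∃ (X : Type u) (_ : MetricSpace X),
          CompleteSpace X ∧ Nonempty (G ≃ₜ* (X ≃ᵢ X)) ∧ topWeight X = topWeight G)) := by
  -- The constructed space lives in the universe of `G` and is lifted to `max u v` for the
  -- equivalences.
  have hlift : ∀ (X : Type u) [MetricSpace X], ∃ _ : X ≃ᵢ ULift.{v} X, True := fun X _ =>
    ⟨⟨Equiv.ulift.symm, fun _ _ => rfl⟩, trivial⟩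
  refine ⟨⟨⟨?_, fun h => ?_⟩, exists_metricSpace_of_isGdeltaComplete⟩,
    ⟨⟨?_, fun h => ?_⟩, exists_completeSpace_of_isRaikovComplete⟩⟩
  · rintro ⟨X, _, ⟨φ⟩⟩
    exact isGdeltaComplete_of_isometryEquiv φ
  · obtain ⟨X, _, ⟨φ⟩, -⟩ := exists_metricSpace_of_isGdeltaComplete h
    obtain ⟨e, -⟩ := hlift X
    obtain ⟨ψ⟩ := e.nonempty_continuousMulEquiv
    exact ⟨ULift.{v} X, inferInstance, ⟨φ.trans ψ⟩⟩
  · rintro ⟨X, _, _, ⟨φ⟩⟩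
    exact isRaikovComplete_of_isometryEquiv φ
  · obtain ⟨X, _, _, ⟨φ⟩, -⟩ := exists_completeSpace_of_isRaikovComplete h
    obtain ⟨e, -⟩ := hlift X
    obtain ⟨ψ⟩ := e.nonempty_continuousMulEquiv
    exact ⟨ULift.{v} X, inferInstance, inferInstance, ⟨φ.trans ψ⟩⟩

end Main
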